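/- Let $n$ be the number of agents and $t_0\in\mathbb R$. A Carathéodory trajectory of the closed continuous-time Hegselmann–Krause dynamics is a function $x:[t_0,\infty)\to\mathbb R^n$ such that, for every agent $i$ and every $t\ge t_0$, the integrand below is integrable on $[t_0,t]$ and $$x_i(t)=x_i(t_0)+\int_{t_0}^t\ \sum_{j:\,|x_i(\tau)-x_j(\tau)|<1}\bigl(x_j(\tau)-x_i(\tau)\bigr)\,d\tau .$$ For $x\in\mathbb R^n$, join two distinct agents $i,j$ by an edge when $|x_i-x_j|<1$, call the connected components of this graph clusters, let $\bar x_i$ be the average of the opinions in the cluster of agent $i$, and put $$U(x)=\frac1n\sum_{i=1}^n (x_i-\bar x_i)^2 .$$ Proposition. (a) For Lebesgue-almost every initial condition $x_0\in\mathbb R^n$, the function $t\mapsto U(x(t))$ is non-increasing on $[t_0,\infty)$ along every Carathéodory trajectory $x$ with $x(t_0)=x_0$. (b) Along every Carathéodory trajectory $x$, from any initial condition, $\lim_{t\to\infty}U(x(t))=0$. -/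

import Mathlib

open MeasureTheory

namespace HK

noncomputable section

open scoped Classical in
/-- The Hegselmann-Krause vector field: agent `i` is attracted by all agents at distance
strictly less than `1`. -/
def field {n : ℕ} (x : Fin n → ℝ) (i : Fin n) : ℝ :=
  ∑ j with |x i - x j| < 1, (x j - x i)

/-- `x` is a Carathéodory solution on `[t₀, ∞)`: the right-hand side is integrable along `x`
on every `[t₀, t]`, and `x` satisfies the integral equation. -/
def IsCaratheodorySolution {n : ℕ} (t₀ : ℝ) (x : ℝ → Fin n → ℝ) : Prop :=
  ∀ i : Fin n, ∀ t : ℝ, t₀ ≤ t →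
    IntervalIntegrable (fun τ => field (x τ) i) volume t₀ t ∧
      x t i = x t₀ i + ∫ τ in t₀..t, field (x τ) i

/-- The interaction graph of a configuration. -/
def interactionGraph {n : ℕ} (x : Fin n → ℝ) : SimpleGraph (Fin n) where
  Adj i j := i ≠ j ∧ |x i - x j| < 1
  symm := ⟨fun i j h => ⟨h.1.symm, by rw [abs_sub_comm]; exact h.2⟩⟩
  loopless := ⟨fun _ h => h.1 rfl⟩

open scoped Classical in
/-- The cluster of agent `i`: its connected component in the interaction graph. -/
def cluster {n : ℕ} (x : Fin n → ℝ) (i : Fin n) : Finset (Fin n) :=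
  {j | (interactionGraph x).Reachable i j}

/-- The average opinion in the cluster of agent `i` (the cluster contains `i`). -/
def clusterMean {n : ℕ} (x : Fin n → ℝ) (i : Fin n) : ℝ :=
  (∑ j ∈ cluster x i, x j) / ((cluster x i).card : ℝ)

/-- The local variance: average squared deviation of the agents from their cluster means. -/
def localVariance {n : ℕ} (x : Fin n → ℝ) : ℝ :=
  (1 / (n : ℝ)) * ∑ i, (x i - clusterMean x i) ^ 2

end

end HK

namespace HK

open Set Filter Topology

/-! The field is a sum of kernels `-pull (x i - x j)`. Since `pull` jumps only downwards, it is
one-sided Lipschitz (`pull_sub_mul_le`). Two trajectories may therefore merge no faster than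
exponentially (`sum_sq_sub_le`): forward uniqueness can fail, but positions at time t determine the
initial condition, in a Lipschitz way. Comparing a trajectory with its relabelling under a
transposition shows that distinct agents never meet, so their order is preserved.

Both parts use that cluster means minimize the squared deviation among vectors constant on clusters
(`localVariance_le`), and that the squared distance to a fixed vector c does not increase while only
agents with equal entries of c interact (`sum_sq_sub_const_le`).

For (a), the Lipschitz inverse flow shows, by counting Hausdorff dimension, that almost no initial
condition reaches a hyperplane at a prescribed time, or a subspace of codimension two at any time. A
generic trajectory thus avoids tangencies and simultaneous unit distances, and consecutive agents at
distance at least one never begin to interact (`one_le_gap`). Clusters can only split, so the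
cluster means at time s serve as c at all later times.

For (b), sums over lower sets of agents are monotone and bounded, so every agent converges, and
distinct limits are at least one apart. The delicate case is limits exactly one apart: a bounded
potential measuring the interactions across unit gaps would grow at rate 1/2 forever if it were ever
positive at a late time (`eventually_limit_eq`). Hence eventually only agents with a common limit
interact, and the limits serve as c. -/

/-! ### Monotonicity of absolutely continuous functions -/

/-- An absolutely continuous function with almost everywhere nonnegative derivative does not
decrease. -/
theorem le_of_ae_hasDerivAt_nonneg {f : ℝ → ℝ} {a b : ℝ} (hab : a ≤ b)
    (hf : AbsolutelyContinuousOnInterval f a b)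
    (h : ∀ᵐ t, t ∈ Ioo a b → ∃ d, 0 ≤ d ∧ HasDerivAt f d t) : f a ≤ f b := by
  have hI := hf.integral_deriv_eq_sub
  have h0 : 0 ≤ ∫ t in a..b, deriv f t := by
    apply intervalIntegral.integral_nonneg_of_ae_restrict hab
    rw [← restrict_Ioo_eq_restrict_Icc]
    refine (ae_restrict_iff' measurableSet_Ioo).2 ?_
    filter_upwards [h] with t ht hmem
    obtain ⟨d, hd, hder⟩ := ht hmem
    rw [hder.deriv]
    exact hd
  linarith

theorem absolutelyContinuousOnInterval_sum {ι : Type*} (s : Finset ι) {f : ι → ℝ → ℝ} {a b : ℝ}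
    (hf : ∀ i ∈ s, AbsolutelyContinuousOnInterval (f i) a b) :
    AbsolutelyContinuousOnInterval (fun t => ∑ i ∈ s, f i t) a b := by
  classical
  induction s using Finset.induction_on with
  | empty =>
    simpa using (contDiff_const (c := (0 : ℝ))).contDiffOn.absolutelyContinuousOnInterval
      (a := a) (b := b)
  | insert i s hi ih =>
    simp only [Finset.sum_insert hi]
    exact (hf i (by simp)).add (ih fun j hj => hf j (by simp [hj]))

theorem absolutelyContinuousOnInterval_const (c a b : ℝ) :
    AbsolutelyContinuousOnInterval (fun _ => c) a b :=
  contDiff_const.contDiffOn.absolutelyContinuousOnInterval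

/-! ### The interaction kernel and summation by parts -/

open scoped Classical in
/-- The truncated identity: the attraction between two agents at signed distance `u`. -/
noncomputable def pull (u : ℝ) : ℝ := if |u| < 1 then u else 0

theorem pull_of_lt {u : ℝ} (h : |u| < 1) : pull u = u := if_pos h

theorem pull_of_le {u : ℝ} (h : 1 ≤ |u|) : pull u = 0 := if_neg h.not_gt

theorem pull_neg (u : ℝ) : pull (-u) = -pull u := by
  unfold pull; rw [abs_neg]; split_ifs <;> simp

theorem abs_pull_le (u : ℝ) : |pull u| ≤ 1 := by
  unfold pull; split_ifs with h
  · exact h.le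
  · simp

theorem pull_nonneg {u : ℝ} (h : 0 ≤ u) : 0 ≤ pull u := by
  unfold pull; split_ifs <;> simp [h]

theorem pull_nonpos {u : ℝ} (h : u ≤ 0) : pull u ≤ 0 := by
  unfold pull; split_ifs <;> simp [h]

theorem pull_mul_self_nonneg (u : ℝ) : 0 ≤ pull u * u := by
  unfold pull; split_ifs <;> simp [mul_self_nonneg]

/-- `pull` has slope at most 1 and jumps down at both 1 and -1, so its difference quotients never
exceed 1. This one-sided bound replaces the Lipschitz condition that the field lacks. -/
theorem pull_sub_mul_le (a b : ℝ) : (pull a - pull b) * (a - b) ≤ (a - b) ^ 2 := by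
  unfold pull
  split_ifs with h1 h2 h2
  · exact le_of_eq (by ring)
  · rw [abs_lt] at h1
    rcases le_abs.1 (not_lt.1 h2) with h | h <;> nlinarith
  · rw [abs_lt] at h2
    rcases le_abs.1 (not_lt.1 h1) with h | h <;> nlinarith
  · nlinarith [sq_nonneg (a - b)]

variable {n : ℕ}

theorem field_eq_sum_pull (x : Fin n → ℝ) (i : Fin n) :
    field x i = -∑ j, pull (x i - x j) := by
  classical
  unfold field pull
  rw [Finset.sum_filter, ← Finset.sum_neg_distrib]
  refine Finset.sum_congr rfl fun j _ => ?_
  split_ifs <;> ring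

theorem abs_field_le (x : Fin n → ℝ) (i : Fin n) : |field x i| ≤ n := by
  rw [field_eq_sum_pull, abs_neg]
  refine (Finset.abs_sum_le_sum_abs _ _).trans ?_
  refine (Finset.sum_le_sum fun j _ => abs_pull_le (x i - x j)).trans ?_
  simp

/-- Summation by parts for the vector field. -/
theorem sum_field_mul (x z : Fin n → ℝ) :
    ∑ i, field x i * z i = -(1 / 2) * ∑ i, ∑ j, pull (x i - x j) * (z i - z j) := by
  have h1 : ∑ i, field x i * z i = -∑ i, ∑ j, pull (x i - x j) * z i := by
    simp_rw [field_eq_sum_pull, neg_mul, Finset.sum_mul, Finset.sum_neg_distrib]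
  have h2 : ∑ i, ∑ j, pull (x i - x j) * z j = -∑ i, ∑ j, pull (x i - x j) * z i := by
    rw [Finset.sum_comm, ← Finset.sum_neg_distrib]
    refine Finset.sum_congr rfl fun i _ => ?_
    rw [← Finset.sum_neg_distrib]
    refine Finset.sum_congr rfl fun j _ => ?_
    rw [← neg_sub (x i) (x j), pull_neg, neg_mul]
  simp_rw [mul_sub, Finset.sum_sub_distrib]
  rw [h1, h2]
  ring

/-! ### Regularity of trajectories and the backward estimate -/

namespace IsCaratheodorySolution

variable {t₀ : ℝ} {x y : ℝ → Fin n → ℝ}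

theorem intervalIntegrable (hx : IsCaratheodorySolution t₀ x) (i : Fin n) {s t : ℝ}
    (hs : t₀ ≤ s) (ht : t₀ ≤ t) : IntervalIntegrable (fun τ => field (x τ) i) volume s t :=
  (hx i s hs).1.symm.trans (hx i t ht).1

theorem sub_eq_integral (hx : IsCaratheodorySolution t₀ x) (i : Fin n) {s t : ℝ}
    (hs : t₀ ≤ s) (ht : t₀ ≤ t) : x t i - x s i = ∫ τ in s..t, field (x τ) i := by
  rw [(hx i t ht).2, (hx i s hs).2,
    ← intervalIntegral.integral_interval_sub_left (hx i t ht).1 (hx i s hs).1]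
  ring

theorem lipschitzOnWith (hx : IsCaratheodorySolution t₀ x) (i : Fin n) :
    LipschitzOnWith n (fun t => x t i) (Ici t₀) := by
  refine LipschitzOnWith.of_dist_le_mul fun s hs t ht => ?_
  rw [Real.dist_eq, Real.dist_eq, hx.sub_eq_integral i ht hs]
  have := intervalIntegral.norm_integral_le_of_norm_le_const (a := t) (b := s)
    (f := fun τ => field (x τ) i) (C := n) fun τ _ => abs_field_le (x τ) i
  simpa using this

theorem continuousOn (hx : IsCaratheodorySolution t₀ x) (i : Fin n) :
    ContinuousOn (fun t => x t i) (Ici t₀) := (hx.lipschitzOnWith i).continuousOn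

theorem absolutelyContinuousOnInterval (hx : IsCaratheodorySolution t₀ x) (i : Fin n) {a b : ℝ}
    (ha : t₀ ≤ a) (hb : t₀ ≤ b) : AbsolutelyContinuousOnInterval (fun t => x t i) a b :=
  ((hx.lipschitzOnWith i).mono fun _ ht => (le_min ha hb).trans ht.1).absolutelyContinuousOnInterval

theorem ae_hasDerivAt (hx : IsCaratheodorySolution t₀ x) :
    ∀ᵐ t, t₀ < t → ∀ i, HasDerivAt (fun t => x t i) (field (x t) i) t := by
  have h : ∀ i : Fin n, ∀ N : ℕ, ∀ᵐ t, t ∈ uIcc t₀ (t₀ + N) → ∀ c ∈ uIcc t₀ (t₀ + N),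
      HasDerivAt (fun t => ∫ τ in c..t, field (x τ) i) (field (x t) i) t := fun i N =>
    (hx i (t₀ + N) (by simp)).1.ae_hasDerivAt_integral
  filter_upwards [ae_all_iff.2 fun i => ae_all_iff.2 (h i)] with t ht h0 i
  obtain ⟨N, hN⟩ := exists_nat_ge (t - t₀)
  have h1 := ht i N (by rw [mem_uIcc]; left; constructor <;> linarith) t₀ (by simp)
  refine (h1.const_add (x t₀ i)).congr_of_eventuallyEq ?_
  filter_upwards [Ioi_mem_nhds h0] with s hs
  exact (hx i s (le_of_lt hs)).2

theorem shift (hx : IsCaratheodorySolution t₀ x) {c : ℝ} (hc : 0 ≤ c) :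
    IsCaratheodorySolution t₀ (fun t => x (t + c)) := by
  intro i t ht
  have h1 := hx.intervalIntegrable i (s := t₀ + c) (t := t + c) (by linarith) (by linarith)
  have h2 := hx.sub_eq_integral i (s := t₀ + c) (t := t + c) (by linarith) (by linarith)
  constructor
  · simpa using h1.comp_add_right c
  · rw [intervalIntegral.integral_comp_add_right (fun τ => field (x τ) i), ← h2]
    ring

theorem comp_perm (hx : IsCaratheodorySolution t₀ x) (σ : Equiv.Perm (Fin n)) :
    IsCaratheodorySolution t₀ (fun t i => x t (σ i)) := by
  have h : ∀ t i, field (fun k => x t (σ k)) i = field (x t) (σ i) := by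
    intro t i
    rw [field_eq_sum_pull, field_eq_sum_pull]
    exact congrArg _ (Equiv.sum_comp σ fun j => pull (x t (σ i) - x t j))
  intro i t ht
  simp only [h]
  exact hx (σ i) t ht

/-- Two solutions separate at most exponentially fast backwards in time. -/
theorem sum_sq_sub_le (hx : IsCaratheodorySolution t₀ x) (hy : IsCaratheodorySolution t₀ y)
    {s t : ℝ} (hs : t₀ ≤ s) (hst : s ≤ t) :
    ∑ i, (x s i - y s i) ^ 2 ≤ Real.exp (2 * n * (t - s)) * ∑ i, (x t i - y t i) ^ 2 := by
  have ht := hs.trans hst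
  -- The exponential weight compensates the fastest possible merging, so that `F` is nondecreasing.
  let F : ℝ → ℝ := fun τ => Real.exp (2 * n * (τ - s)) * ∑ i, (x τ i - y τ i) ^ 2
  have hac : AbsolutelyContinuousOnInterval F s t := by
    refine AbsolutelyContinuousOnInterval.fun_mul (ContDiff.contDiffOn
      (by fun_prop)).absolutelyContinuousOnInterval ?_
    refine absolutelyContinuousOnInterval_sum _ fun i _ => ?_
    have h := (hx.absolutelyContinuousOnInterval i hs ht).fun_sub
      (hy.absolutelyContinuousOnInterval i hs ht)
    simpa only [pow_two] using h.fun_mul h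
  have key : F s ≤ F t := by
    refine le_of_ae_hasDerivAt_nonneg hst hac ?_
    filter_upwards [hx.ae_hasDerivAt, hy.ae_hasDerivAt] with τ h1 h2 hτ
    have h1 := h1 (hs.trans_lt hτ.1)
    have h2 := h2 (hs.trans_lt hτ.1)
    have hsum : HasDerivAt (fun τ => ∑ i, (x τ i - y τ i) ^ 2)
        (∑ i, 2 * (x τ i - y τ i) * (field (x τ) i - field (y τ) i)) τ := by
      refine HasDerivAt.fun_sum fun i _ => ?_
      simpa using ((h1 i).fun_sub (h2 i)).fun_pow 2
    have hexp : HasDerivAt (fun τ => Real.exp (2 * n * (τ - s)))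
        (Real.exp (2 * n * (τ - s)) * (2 * n)) τ := by
      simpa using (((hasDerivAt_id τ).sub_const s).const_mul (2 * n : ℝ)).exp
    refine ⟨_, ?_, hexp.fun_mul hsum⟩
    have hmono : -(2 * n * ∑ i, (x τ i - y τ i) ^ 2) ≤
        ∑ i, 2 * (x τ i - y τ i) * (field (x τ) i - field (y τ) i) := by
      set w : Fin n → ℝ := fun i => x τ i - y τ i with hw
      have e1 : ∑ i, 2 * (x τ i - y τ i) * (field (x τ) i - field (y τ) i) =
          2 * (∑ i, field (x τ) i * w i) - 2 * ∑ i, field (y τ) i * w i := by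
        rw [Finset.mul_sum, Finset.mul_sum, ← Finset.sum_sub_distrib]
        exact Finset.sum_congr rfl fun i _ => by simp only [hw]; ring
      -- Dropping the square of the total of `w` bounds this double sum by 2n times the sum of
      -- squares, the source of the rate 2n.
      have e2 : ∑ i, ∑ j, (w i - w j) ^ 2 = 2 * (n * ∑ i, w i ^ 2) - 2 * (∑ i, w i) ^ 2 := by
        have : ∀ i j, (w i - w j) ^ 2 = w i ^ 2 + w j ^ 2 - 2 * (w i * w j) := fun i j => by ring
        simp_rw [this, Finset.sum_sub_distrib, Finset.sum_add_distrib, ← Finset.mul_sum,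
          ← Finset.sum_mul]
        simp
        rw [← Finset.mul_sum]
        ring
      have e3 : ∑ i, ∑ j, pull (x τ i - x τ j) * (w i - w j) -
          ∑ i, ∑ j, pull (y τ i - y τ j) * (w i - w j) ≤ ∑ i, ∑ j, (w i - w j) ^ 2 := by
        simp_rw [← Finset.sum_sub_distrib]
        refine Finset.sum_le_sum fun i _ => Finset.sum_le_sum fun j _ => ?_
        have := pull_sub_mul_le (x τ i - x τ j) (y τ i - y τ j)
        have e : x τ i - x τ j - (y τ i - y τ j) = w i - w j := by simp only [hw]; ring
        rw [e] at this
        linarith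
      rw [e1, sum_field_mul, sum_field_mul]
      have : ∑ i, (x τ i - y τ i) ^ 2 = ∑ i, w i ^ 2 := rfl
      rw [this]
      nlinarith [sq_nonneg (∑ i, w i)]
    have hpos := Real.exp_pos (2 * n * (τ - s))
    nlinarith
  simpa [F] using key

/-- Two agents at different positions never meet. -/
theorem ne_of_ne (hx : IsCaratheodorySolution t₀ x) {i j : Fin n} {s t : ℝ} (hs : t₀ ≤ s)
    (hst : s ≤ t) (h : x s i ≠ x s j) : x t i ≠ x t j := by
  intro heq
  -- If i and j meet at time t, the trajectory and its swapped copy coincide there, hence also at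
  -- time s.
  have key := hx.sum_sq_sub_le (hx.comp_perm (Equiv.swap i j)) hs hst
  have h0 : ∑ k, (x t k - x t (Equiv.swap i j k)) ^ 2 = 0 := by
    refine Finset.sum_eq_zero fun k _ => ?_
    by_cases hki : k = i
    · subst hki; simp [heq]
    · by_cases hkj : k = j
      · subst hkj; simp [heq]
      · simp [Equiv.swap_apply_of_ne_of_ne hki hkj]
  rw [h0, mul_zero] at key
  have h1 : (x s i - x s (Equiv.swap i j i)) ^ 2 ≤ ∑ k, (x s k - x s (Equiv.swap i j k)) ^ 2 :=
    Finset.single_le_sum (f := fun k => (x s k - x s (Equiv.swap i j k)) ^ 2)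
      (fun k _ => sq_nonneg _) (Finset.mem_univ i)
  rw [Equiv.swap_apply_left] at h1
  have h2 : x s i - x s j = 0 := by
    have := le_antisymm (h1.trans key) (sq_nonneg _)
    exact pow_eq_zero_iff (two_ne_zero) |>.1 this
  exact h (sub_eq_zero.1 h2)

/-- Strict order between agents is preserved forward in time. -/
theorem lt_of_lt (hx : IsCaratheodorySolution t₀ x) {i j : Fin n} {s t : ℝ} (hs : t₀ ≤ s)
    (hst : s ≤ t) (h : x s i < x s j) : x t i < x t j := by
  by_contra hcon
  rw [not_lt] at hcon
  have hc : ContinuousOn (fun τ => x τ j - x τ i) (Icc s t) :=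
    ((hx.continuousOn j).sub (hx.continuousOn i)).mono fun τ hτ => hs.trans hτ.1
  obtain ⟨τ, hτ, h0⟩ := intermediate_value_Icc' hst hc (show (0 : ℝ) ∈ Icc _ _ from
    ⟨by simpa using hcon, by simpa using h.le⟩)
  exact hx.ne_of_ne hs hτ.1 h.ne (sub_eq_zero.1 h0).symm

/-- If every agent interacts on `[s, t]` only with agents having the same reference point, then
the distance to the reference configuration does not increase. -/
theorem sum_sq_sub_const_le (hx : IsCaratheodorySolution t₀ x) (c : Fin n → ℝ) {s t : ℝ}
    (hs : t₀ ≤ s) (hst : s ≤ t)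
    (hc : ∀ τ ∈ Icc s t, ∀ i j, |x τ i - x τ j| < 1 → c i = c j) :
    ∑ i, (x t i - c i) ^ 2 ≤ ∑ i, (x s i - c i) ^ 2 := by
  have ht := hs.trans hst
  have hac : AbsolutelyContinuousOnInterval (fun τ => -∑ i, (x τ i - c i) ^ 2) s t := by
    refine AbsolutelyContinuousOnInterval.fun_neg ?_
    refine absolutelyContinuousOnInterval_sum _ fun i _ => ?_
    have h := (hx.absolutelyContinuousOnInterval i hs ht).fun_sub
      (absolutelyContinuousOnInterval_const (c i) s t)
    simpa only [pow_two] using h.fun_mul h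
  suffices h : ∀ᵐ τ, τ ∈ Ioo s t →
      ∃ d, 0 ≤ d ∧ HasDerivAt (fun τ => -∑ i, (x τ i - c i) ^ 2) d τ from
    neg_le_neg_iff.1 (le_of_ae_hasDerivAt_nonneg (f := fun τ => -∑ i, (x τ i - c i) ^ 2) hst hac h)
  filter_upwards [hx.ae_hasDerivAt] with τ h1 hτ
  have h1 := h1 (hs.trans_lt hτ.1)
  have hsum : HasDerivAt (fun τ => ∑ i, (x τ i - c i) ^ 2)
      (∑ i, 2 * (x τ i - c i) * field (x τ) i) τ := by
    refine HasDerivAt.fun_sum fun i _ => ?_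
    simpa using ((h1 i).sub_const (c i)).fun_pow 2
  refine ⟨_, ?_, hsum.fun_neg⟩
  have e1 : ∑ i, 2 * (x τ i - c i) * field (x τ) i =
      2 * ∑ i, field (x τ) i * (x τ i - c i) := by
    rw [Finset.mul_sum]; exact Finset.sum_congr rfl fun i _ => by ring
  have e2 : 0 ≤ ∑ i, ∑ j, pull (x τ i - x τ j) * ((x τ i - c i) - (x τ j - c j)) := by
    refine Finset.sum_nonneg fun i _ => Finset.sum_nonneg fun j _ => ?_
    by_cases h : |x τ i - x τ j| < 1
    · rw [hc τ (Ioo_subset_Icc_self hτ) i j h, sub_sub_sub_cancel_right]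
      exact pull_mul_self_nonneg _
    · rw [pull_of_le (not_lt.1 h), zero_mul]
  rw [e1, sum_field_mul (x τ) fun i => x τ i - c i]
  linarith

end IsCaratheodorySolution

/-! ### Clusters and the variational property of the local variance -/

theorem mem_cluster {x : Fin n → ℝ} {i j : Fin n} :
    j ∈ cluster x i ↔ (interactionGraph x).Reachable i j := by
  simp [cluster]

theorem mem_cluster_comm {x : Fin n → ℝ} {i j : Fin n} :
    j ∈ cluster x i ↔ i ∈ cluster x j := by
  rw [mem_cluster, mem_cluster]; exact ⟨fun h => h.symm, fun h => h.symm⟩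

theorem cluster_eq_of_reachable {x : Fin n → ℝ} {i j : Fin n}
    (h : (interactionGraph x).Reachable i j) : cluster x i = cluster x j := by
  ext k
  rw [mem_cluster, mem_cluster]
  exact ⟨fun h' => h.symm.trans h', fun h' => h.trans h'⟩

theorem clusterMean_eq_of_reachable {x : Fin n → ℝ} {i j : Fin n}
    (h : (interactionGraph x).Reachable i j) : clusterMean x i = clusterMean x j := by
  unfold clusterMean; rw [cluster_eq_of_reachable h]

theorem cluster_card_pos (x : Fin n → ℝ) (i : Fin n) : 0 < ((cluster x i).card : ℝ) := by
  exact_mod_cast Finset.card_pos.2 ⟨i, mem_cluster.2 (SimpleGraph.Reachable.refl i)⟩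

theorem reachable_of_abs_lt {x : Fin n → ℝ} {i j : Fin n} (h : |x i - x j| < 1) :
    (interactionGraph x).Reachable i j := by
  by_cases hij : i = j
  · subst hij; exact SimpleGraph.Reachable.refl i
  · exact SimpleGraph.Adj.reachable (G := interactionGraph x) ⟨hij, h⟩

theorem eq_of_reachable {α : Type*} {x : Fin n → ℝ} {c : Fin n → α}
    (hc : ∀ i j, |x i - x j| < 1 → c i = c j) {i j : Fin n}
    (h : (interactionGraph x).Reachable i j) : c i = c j := by
  obtain ⟨p⟩ := h
  induction p with
  | nil => rfl
  | cons h _ ih => exact (hc _ _ h.2).trans ih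

/-- Deviations from the cluster means are orthogonal to functions constant on clusters. -/
theorem sum_mul_sub_clusterMean (x d : Fin n → ℝ)
    (hd : ∀ i j, (interactionGraph x).Reachable i j → d i = d j) :
    ∑ i, d i * (x i - clusterMean x i) = 0 := by
  classical
  have h : ∑ i, d i * clusterMean x i = ∑ j, d j * x j := by
    have e1 : ∀ i, d i * clusterMean x i =
        ∑ j, if j ∈ cluster x i then d j * x j / (cluster x j).card else 0 := by
      intro i
      rw [clusterMean, ← Finset.sum_filter, Finset.filter_mem_eq_inter, Finset.univ_inter,
        Finset.sum_div, Finset.mul_sum]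
      refine Finset.sum_congr rfl fun j hj => ?_
      rw [mem_cluster] at hj
      rw [hd i j hj, cluster_eq_of_reachable hj, mul_div_assoc]
    simp_rw [e1]
    rw [Finset.sum_comm]
    refine Finset.sum_congr rfl fun j _ => ?_
    simp_rw [mem_cluster_comm (j := j)]
    rw [← Finset.sum_filter, Finset.filter_mem_eq_inter, Finset.univ_inter, Finset.sum_const,
      nsmul_eq_mul]
    have := (cluster_card_pos x j).ne'
    field_simp
  simp_rw [mul_sub, Finset.sum_sub_distrib, h, sub_self]

/-- The cluster means minimize the squared deviation among functions constant on clusters. -/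
theorem localVariance_le (x c : Fin n → ℝ) (hc : ∀ i j, |x i - x j| < 1 → c i = c j) :
    localVariance x ≤ (1 / (n : ℝ)) * ∑ i, (x i - c i) ^ 2 := by
  unfold localVariance
  refine mul_le_mul_of_nonneg_left ?_ (by positivity)
  have horth := sum_mul_sub_clusterMean x (fun i => clusterMean x i - c i) fun i j h => by
    rw [clusterMean_eq_of_reachable h, eq_of_reachable hc h]
  have : ∑ i, (x i - c i) ^ 2 = ∑ i, (x i - clusterMean x i) ^ 2 +
      2 * (∑ i, (clusterMean x i - c i) * (x i - clusterMean x i)) +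
      ∑ i, (clusterMean x i - c i) ^ 2 := by
    rw [Finset.mul_sum, ← Finset.sum_add_distrib, ← Finset.sum_add_distrib]
    exact Finset.sum_congr rfl fun i _ => by ring
  rw [this, horth]
  have := Finset.sum_nonneg fun i (_ : i ∈ Finset.univ) => sq_nonneg (clusterMean x i - c i)
  linarith

theorem localVariance_nonneg (x : Fin n → ℝ) : 0 ≤ localVariance x :=
  mul_nonneg (by positivity) (Finset.sum_nonneg fun _ _ => sq_nonneg _)

/-! ### Convergence of every agent -/

/-- A set of agents lying below all other agents is pulled upwards. -/
theorem sum_field_nonneg {x : Fin n → ℝ} {A : Finset (Fin n)}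
    (hA : ∀ p ∈ A, ∀ q ∉ A, x p ≤ x q) : 0 ≤ ∑ p ∈ A, field x p ∧
      ∀ i ∈ A, ∀ j ∉ A, x j - x i < 1 → (x j - x i) / 2 ≤ ∑ p ∈ A, field x p := by
  classical
  let z : Fin n → ℝ := fun i => if i ∈ A then 1 else 0
  have e1 : ∑ p ∈ A, field x p = ∑ p, ∑ q, -(1 / 2) * (pull (x p - x q) * (z p - z q)) := by
    have : ∑ p ∈ A, field x p = ∑ p, field x p * z p := by simp [z]
    rw [this, sum_field_mul, Finset.mul_sum]
    simp_rw [Finset.mul_sum]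
  have e2 : ∀ p q, 0 ≤ -(1 / 2) * (pull (x p - x q) * (z p - z q)) := by
    intro p q
    by_cases hp : p ∈ A <;> by_cases hq : q ∈ A <;> simp only [z, hp, hq, if_true, if_false]
    · simp
    · have := pull_nonpos (sub_nonpos.2 (hA p hp q hq))
      linarith
    · have := pull_nonneg (sub_nonneg.2 (hA q hq p hp))
      linarith
    · simp
  rw [e1]
  refine ⟨Finset.sum_nonneg fun p _ => Finset.sum_nonneg fun q _ => e2 p q, ?_⟩
  intro i hi j hj hlt
  -- All terms are nonnegative, so the single ordered pair (i, j) already gives the lower bound; its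
  -- mirror image is discarded, whence the factor 1/2.
  have h1 : -(1 / 2) * (pull (x i - x j) * (z i - z j)) = (x j - x i) / 2 := by
    have := hA i hi j hj
    rw [pull_of_lt (by rw [abs_lt]; constructor <;> linarith)]
    simp only [z, hi, hj, if_true, if_false]
    ring
  rw [← h1]
  exact (Finset.single_le_sum (f := fun q => -(1 / 2) * (pull (x i - x q) * (z i - z q)))
    (fun q _ => e2 i q) (Finset.mem_univ j)).trans
    (Finset.single_le_sum (f := fun p => ∑ q, -(1 / 2) * (pull (x p - x q) * (z p - z q)))
    (fun p _ => Finset.sum_nonneg fun q _ => e2 p q) (Finset.mem_univ i))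

namespace IsCaratheodorySolution

variable {t₀ : ℝ} {x : ℝ → Fin n → ℝ}

theorem sum_sub_eq_integral (hx : IsCaratheodorySolution t₀ x) (A : Finset (Fin n)) {s t : ℝ}
    (hs : t₀ ≤ s) (ht : t₀ ≤ t) :
    IntervalIntegrable (fun τ => ∑ p ∈ A, field (x τ) p) volume s t ∧
    ∑ p ∈ A, x t p - ∑ p ∈ A, x s p = ∫ τ in s..t, ∑ p ∈ A, field (x τ) p := by
  constructor
  · have := IntervalIntegrable.sum A (f := fun p τ => field (x τ) p)
      fun p _ => hx.intervalIntegrable p hs ht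
    simpa only [Finset.sum_fn] using this
  · rw [intervalIntegral.integral_finsetSum fun p _ => hx.intervalIntegrable p hs ht,
      ← Finset.sum_sub_distrib]
    exact Finset.sum_congr rfl fun p _ => hx.sub_eq_integral p hs ht

theorem eventually_order (hx : IsCaratheodorySolution t₀ x) (i j : Fin n) :
    (∀ᶠ t in atTop, x t i < x t j) ∨ (∀ᶠ t in atTop, x t i = x t j) ∨
      (∀ᶠ t in atTop, x t j < x t i) := by
  by_cases h : ∀ t, t₀ ≤ t → x t i = x t j
  · exact Or.inr (Or.inl ((eventually_ge_atTop t₀).mono h))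
  · push Not at h
    obtain ⟨s, hs, hne⟩ := h
    rcases lt_or_gt_of_ne hne with hlt | hlt
    · exact Or.inl ((eventually_ge_atTop s).mono fun t ht => hx.lt_of_lt hs ht hlt)
    · exact Or.inr (Or.inr ((eventually_ge_atTop s).mono fun t ht => hx.lt_of_lt hs ht hlt))

theorem exists_abs_le (hx : IsCaratheodorySolution t₀ x) :
    ∃ M, ∀ t, t₀ ≤ t → ∀ i, |x t i| ≤ M := by
  refine ⟨Real.sqrt (∑ i, (x t₀ i - 0) ^ 2), fun t ht i => Real.abs_le_sqrt ?_⟩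
  refine le_trans ?_ (hx.sum_sq_sub_const_le (fun _ => 0) le_rfl ht fun _ _ _ _ _ => rfl)
  simpa using Finset.single_le_sum (f := fun i => x t i ^ 2) (fun i _ => sq_nonneg _)
    (Finset.mem_univ i)

/-- Attractions inside `A` cancel and those from outside point upwards, so the sum is eventually
nondecreasing; it is bounded because the distance to the origin never grows. -/
theorem exists_tendsto_sum (hx : IsCaratheodorySolution t₀ x) (A : Finset (Fin n))
    (hA : ∀ᶠ t in atTop, ∀ p ∈ A, ∀ q ∉ A, x t p ≤ x t q) :
    ∃ S, Tendsto (fun t => ∑ p ∈ A, x t p) atTop (𝓝 S) := by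
  obtain ⟨M, hM⟩ := hx.exists_abs_le
  obtain ⟨T, hT⟩ := eventually_atTop.1 (hA.and (eventually_ge_atTop t₀))
  have hmono : Monotone fun t => ∑ p ∈ A, x (max t T) p := by
    intro s t hst
    have h1 : T ≤ max s T := le_max_right _ _
    have h2 : max s T ≤ max t T := max_le_max_right T hst
    have h0 := (hT T le_rfl).2
    obtain ⟨_, he⟩ := hx.sum_sub_eq_integral A (h0.trans h1) (h0.trans (h1.trans h2))
    have : 0 ≤ ∫ τ in max s T..max t T, ∑ p ∈ A, field (x τ) p :=
      intervalIntegral.integral_nonneg h2 fun τ hτ =>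
        (sum_field_nonneg (hT τ (h1.trans hτ.1)).1).1
    simp only
    linarith
  have hbdd : BddAbove (range fun t => ∑ p ∈ A, x (max t T) p) := by
    refine ⟨A.card * M, ?_⟩
    rintro _ ⟨t, rfl⟩
    have : ∑ p ∈ A, x (max t T) p ≤ ∑ p ∈ A, M := Finset.sum_le_sum fun p _ =>
      (le_abs_self _).trans (hM _ ((hT T le_rfl).2.trans (le_max_right _ _)) p)
    simpa using this
  refine ⟨_, (tendsto_atTop_ciSup hmono hbdd).congr' ?_⟩
  filter_upwards [eventually_ge_atTop T] with t ht
  rw [max_eq_left ht]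

open scoped Classical in
theorem eventually_lowerSet (hx : IsCaratheodorySolution t₀ x) (i : Fin n) :
    ∀ᶠ t in atTop, ∀ p ∈ ({p | ∀ᶠ t in atTop, x t p ≤ x t i} : Finset (Fin n)),
      ∀ q ∉ ({p | ∀ᶠ t in atTop, x t p ≤ x t i} : Finset (Fin n)),
      x t p ≤ x t i ∧ x t i < x t q := by
  simp only [Finset.mem_filter_univ, eventually_all]
  intro p hp q hq
  refine hp.and ?_
  rcases hx.eventually_order q i with h | h | h
  · exact absurd (h.mono fun t ht => ht.le) hq
  · exact absurd (h.mono fun t ht => ht.le) hq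
  · exact h

/-- Every agent converges. -/
theorem exists_tendsto (hx : IsCaratheodorySolution t₀ x) (i : Fin n) :
    ∃ ℓ, Tendsto (fun t => x t i) atTop (𝓝 ℓ) := by
  classical
  -- `A \ B` consists of the agents that eventually coincide with i, so the difference of the two
  -- convergent sums is a fixed positive multiple of `x t i`.
  let A : Finset (Fin n) := {p | ∀ᶠ t in atTop, x t p ≤ x t i}
  let B : Finset (Fin n) := {p | ∀ᶠ t in atTop, x t p < x t i}
  have hBA : B ⊆ A := by
    intro p hp
    simp only [A, B, Finset.mem_filter_univ] at hp ⊢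
    exact hp.mono fun t ht => ht.le
  obtain ⟨SA, hSA⟩ := hx.exists_tendsto_sum A ((hx.eventually_lowerSet i).mono
    fun t ht p hp q hq => (ht p hp q hq).1.trans (ht p hp q hq).2.le)
  obtain ⟨SB, hSB⟩ := hx.exists_tendsto_sum B (by
    simp only [B, Finset.mem_filter_univ, eventually_all]
    intro p hp q hq
    rcases hx.eventually_order q i with h | h | h
    · exact absurd h hq
    · exact (hp.and h).mono fun t ht => ht.2 ▸ ht.1.le
    · exact (hp.and h).mono fun t ht => (ht.1.trans ht.2).le)
  have hcard : 0 < ((A \ B).card : ℝ) := by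
    have : i ∈ A \ B := by
      simpa [A, B] using fun y : ℝ => ⟨y, le_rfl⟩
    exact_mod_cast Finset.card_pos.2 ⟨i, this⟩
  have heq : ∀ᶠ t in atTop, ∀ p ∈ A \ B, x t p = x t i := by
    simp only [eventually_all]
    intro p hp
    simp only [A, B, Finset.mem_sdiff, Finset.mem_filter_univ] at hp
    rcases hx.eventually_order p i with h | h | h
    · exact absurd h hp.2
    · exact h
    · obtain ⟨t, h1, h2⟩ := (hp.1.and h).exists
      exact absurd h1 h2.not_ge
  refine ⟨(SA - SB) / (A \ B).card, ((hSA.sub hSB).div_const _).congr' ?_⟩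
  filter_upwards [heq] with t ht
  rw [← Finset.sum_sdiff hBA, add_sub_cancel_right, Finset.sum_congr rfl ht, Finset.sum_const,
    nsmul_eq_mul]
  field_simp

/-- Two limit positions either coincide or are at distance at least one. -/
theorem one_le_of_limit_lt (hx : IsCaratheodorySolution t₀ x) {ℓ : Fin n → ℝ}
    (hℓ : ∀ i, Tendsto (fun t => x t i) atTop (𝓝 (ℓ i))) {i j : Fin n} (hij : ℓ i < ℓ j) :
    1 ≤ ℓ j - ℓ i := by
  classical
  by_contra hlt
  rw [not_le] at hlt
  let A : Finset (Fin n) := {p | ∀ᶠ t in atTop, x t p ≤ x t i}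
  have hi : i ∈ A := by simp [A]
  have hj : j ∉ A := by
    simp only [A, Finset.mem_filter_univ]
    intro h
    exact hij.not_ge (le_of_tendsto_of_tendsto (hℓ j) (hℓ i) h)
  obtain ⟨M, hM⟩ := hx.exists_abs_le
  set d := ℓ j - ℓ i with hd
  have hd0 : 0 < d := sub_pos.2 hij
  have hdt := (hℓ j).sub (hℓ i)
  obtain ⟨T, hT⟩ := eventually_atTop.1 ((hx.eventually_lowerSet i).and
    ((eventually_ge_atTop t₀).and ((hdt.eventually (lt_mem_nhds (half_lt_self hd0))).and
      (hdt.eventually (gt_mem_nhds hlt)))))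
  -- If the limits were less than one apart, i and j would interact forever at distance above d/2,
  -- and the sum over `A` would grow linearly, against boundedness.
  have hgrow : ∀ t, T ≤ t → d / 4 * (t - T) ≤ ∑ p ∈ A, x t p - ∑ p ∈ A, x T p := by
    intro t ht
    have h0 := (hT T le_rfl).2.1
    obtain ⟨hint, he⟩ := hx.sum_sub_eq_integral A h0 (h0.trans ht)
    rw [he]
    have hc : ∫ _ in T..t, d / 4 = d / 4 * (t - T) := by simp; ring
    rw [← hc]
    refine intervalIntegral.integral_mono_on ht (by simp) hint fun τ hτ => ?_
    obtain ⟨h1, -, h3, h4⟩ := hT τ hτ.1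
    have := (sum_field_nonneg (x := x τ) (A := A)
      fun p hp q hq => (h1 p hp q hq).1.trans (h1 p hp q hq).2.le).2 i hi j hj h4
    linarith
  have hb : ∀ t, t₀ ≤ t → |∑ p ∈ A, x t p| ≤ A.card * M := by
    intro t ht
    refine (Finset.abs_sum_le_sum_abs _ _).trans ?_
    refine (Finset.sum_le_sum fun p _ => hM t ht p).trans ?_
    simp
  have h0 := (hT T le_rfl).2.1
  obtain ⟨N, hN⟩ := exists_nat_gt ((A.card * M + A.card * M) / (d / 4))
  have h1 := hgrow (T + N) (by simp)
  have h2 := abs_le.1 (hb (T + N) (h0.trans (by simp)))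
  have h3 := abs_le.1 (hb T h0)
  rw [div_lt_iff₀ (by positivity)] at hN
  rw [add_sub_cancel_left] at h1
  linarith

end IsCaratheodorySolution

/-! ### Interactions across limits at distance exactly one -/

open scoped Classical in
/-- Indicator of an interaction of `i` with `j` across a pair of reference points at distance
one. -/
noncomputable def crossEdge (ℓ x : Fin n → ℝ) (i j : Fin n) : ℤ :=
  if ℓ j - ℓ i = 1 ∧ x j - x i < 1 then 1 else 0

theorem crossEdge_nonneg (ℓ x : Fin n → ℝ) (i j : Fin n) : 0 ≤ crossEdge ℓ x i j := by
  unfold crossEdge; split_ifs <;> simp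

/-- Near a separated configuration `ℓ`, the field counts the interactions across unit gaps. -/
theorem abs_neg_pull_sub_crossEdge_le {ℓ x : Fin n → ℝ} {ε : ℝ} (hε : ε ≤ 1 / 4)
    (hx : ∀ i, |x i - ℓ i| ≤ ε) (hsep : ∀ i j, ℓ i < ℓ j → 1 ≤ ℓ j - ℓ i)
    (hfar : ∀ i j, 1 < ℓ j - ℓ i → 1 < x j - x i) (i j : Fin n) :
    |-pull (x i - x j) - ((crossEdge ℓ x i j - crossEdge ℓ x j i : ℤ) : ℝ)| ≤ 2 * ε := by
  have hi := abs_le.1 (hx i)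
  have hj := abs_le.1 (hx j)
  rcases lt_trichotomy (ℓ i) (ℓ j) with h | h | h
  · have e1 : crossEdge ℓ x j i = 0 := if_neg fun h' => by linarith [h'.1]
    rcases (hsep i j h).lt_or_eq with h1 | h1
    · have h2 := hfar i j h1
      have e2 : crossEdge ℓ x i j = 0 := if_neg fun h' => by linarith [h'.1]
      rw [e1, e2, pull_of_le (by rw [abs_sub_comm]; exact h2.le.trans (le_abs_self _))]
      simp; linarith
    · by_cases h3 : x j - x i < 1
      · have e2 : crossEdge ℓ x i j = 1 := if_pos ⟨h1.symm, h3⟩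
        rw [e1, e2, pull_of_lt (abs_lt.2 ⟨by linarith, by linarith⟩), abs_le]
        push_cast
        constructor <;> linarith
      · have e2 : crossEdge ℓ x i j = 0 := if_neg fun h' => h3 h'.2
        rw [e1, e2, pull_of_le (by rw [abs_sub_comm]; exact (not_lt.1 h3).trans (le_abs_self _))]
        simp; linarith
  · have e1 : crossEdge ℓ x j i = 0 := if_neg fun h' => by linarith [h'.1]
    have e2 : crossEdge ℓ x i j = 0 := if_neg fun h' => by linarith [h'.1]
    rw [e1, e2, pull_of_lt (abs_lt.2 ⟨by linarith, by linarith⟩), abs_le]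
    push_cast
    constructor <;> linarith
  · have e1 : crossEdge ℓ x i j = 0 := if_neg fun h' => by linarith [h'.1]
    rcases (hsep j i h).lt_or_eq with h1 | h1
    · have h2 := hfar j i h1
      have e2 : crossEdge ℓ x j i = 0 := if_neg fun h' => by linarith [h'.1]
      rw [e1, e2, pull_of_le (h2.le.trans (le_abs_self _))]
      simp; linarith
    · by_cases h3 : x i - x j < 1
      · have e2 : crossEdge ℓ x j i = 1 := if_pos ⟨h1.symm, h3⟩
        rw [e1, e2, pull_of_lt (abs_lt.2 ⟨by linarith, by linarith⟩), abs_le]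
        push_cast
        constructor <;> linarith
      · have e2 : crossEdge ℓ x j i = 0 := if_neg fun h' => h3 h'.2
        rw [e1, e2, pull_of_le ((not_lt.1 h3).trans (le_abs_self _))]
        simp; linarith

/-- Regrouped by agent, the sum becomes `∑ i, field x i * c i`, where `c i` counts the cross edges
going up from i minus those going down. The field is within 1/2 of the integer `c i`, so each term
is at least half of its square. The lowest agent with an upward edge has none going down, so there
`c i` is at least 1. -/
theorem half_le_sum_crossEdge_mul {ℓ x : Fin n → ℝ} {ε : ℝ} (hε : ε ≤ 1 / 4)
    (hεn : n * (2 * ε) ≤ 1 / 2) (hx : ∀ i, |x i - ℓ i| ≤ ε)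
    (hsep : ∀ i j, ℓ i < ℓ j → 1 ≤ ℓ j - ℓ i)
    (hfar : ∀ i j, 1 < ℓ j - ℓ i → 1 < x j - x i)
    (hex : ∃ i j, ℓ j - ℓ i = 1 ∧ x j - x i < 1) :
    1 / 2 ≤ ∑ i, ∑ j, (crossEdge ℓ x i j : ℝ) * (field x i - field x j) := by
  classical
  let c : Fin n → ℤ := fun i => ∑ j, (crossEdge ℓ x i j - crossEdge ℓ x j i)
  have e1 : ∑ i, ∑ j, (crossEdge ℓ x i j : ℝ) * (field x i - field x j) =
      ∑ i, field x i * c i := by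
    have : ∑ i, ∑ j, (crossEdge ℓ x i j : ℝ) * field x j =
        ∑ i, ∑ j, (crossEdge ℓ x j i : ℝ) * field x i := Finset.sum_comm
    simp_rw [mul_sub, Finset.sum_sub_distrib]
    rw [this, ← Finset.sum_sub_distrib]
    refine Finset.sum_congr rfl fun i _ => ?_
    simp only [c]
    push_cast
    rw [← Finset.sum_sub_distrib, Finset.mul_sum]
    exact Finset.sum_congr rfl fun j _ => by ring
  have e2 : ∀ i, |field x i - c i| ≤ 1 / 2 := by
    intro i
    have : field x i - c i = ∑ j, (-pull (x i - x j) -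
        ((crossEdge ℓ x i j - crossEdge ℓ x j i : ℤ) : ℝ)) := by
      rw [Finset.sum_sub_distrib, field_eq_sum_pull, Finset.sum_neg_distrib]
      simp only [c]
      push_cast
      rfl
    rw [this]
    refine (Finset.abs_sum_le_sum_abs _ _).trans ((Finset.sum_le_sum fun j _ =>
      abs_neg_pull_sub_crossEdge_le hε hx hsep hfar i j).trans ?_)
    simpa using hεn
  have e3 : ∀ i, (c i : ℝ) ^ 2 / 2 ≤ field x i * c i := by
    intro i
    have h1 : |(c i : ℝ)| ≤ (c i : ℝ) ^ 2 := by
      have : |c i| ≤ c i ^ 2 := by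
        rw [← Int.natCast_natAbs]; exact Int.natAbs_le_self_sq (c i)
      exact_mod_cast this
    have h2 : |(field x i - c i) * c i| ≤ 1 / 2 * |(c i : ℝ)| := by
      rw [abs_mul]; exact mul_le_mul_of_nonneg_right (e2 i) (abs_nonneg _)
    have h3 := neg_abs_le ((field x i - c i) * c i)
    nlinarith
  obtain ⟨i₁, j₁, h₁⟩ := hex
  obtain ⟨i, hi, hmin⟩ := Finset.exists_min_image
    ({i | ∃ j, ℓ j - ℓ i = 1 ∧ x j - x i < 1} : Finset (Fin n)) ℓ ⟨i₁, by simpa using ⟨j₁, h₁⟩⟩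
  simp only [Finset.mem_filter_univ] at hi hmin
  obtain ⟨j, hj⟩ := hi
  have e4 : ∀ k, crossEdge ℓ x k i = 0 := fun k =>
    if_neg fun h => by linarith [hmin k ⟨i, h⟩, h.1]
  have e5 : 1 ≤ c i := by
    have h1 : crossEdge ℓ x i j = 1 := if_pos hj
    simp only [c, e4, sub_zero]
    rw [← h1]
    exact Finset.single_le_sum (f := fun k => crossEdge ℓ x i k)
      (fun k _ => crossEdge_nonneg ℓ x i k) (Finset.mem_univ j)
  have e6 : (1 : ℝ) ≤ c i := by exact_mod_cast e5
  rw [e1]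
  calc (1 : ℝ) / 2 ≤ (c i : ℝ) ^ 2 / 2 := by nlinarith
    _ ≤ ∑ i, (c i : ℝ) ^ 2 / 2 := Finset.single_le_sum (f := fun i => (c i : ℝ) ^ 2 / 2)
        (fun k _ => by positivity) (Finset.mem_univ i)
    _ ≤ _ := Finset.sum_le_sum fun k _ => e3 k

/-- Where `h` is at least 1 the truncation attains its minimum 0, so its derivative vanishes.
Differentiability has to be assumed because of the corner at `h t = 1`; for the potential it holds
almost everywhere. -/
theorem hasDerivAt_max_zero_one_sub {h : ℝ → ℝ} {h' t : ℝ} (hh : HasDerivAt h h' t)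
    (hd : DifferentiableAt ℝ (fun s => max 0 (1 - h s)) t) :
    HasDerivAt (fun s => max 0 (1 - h s)) (if h t < 1 then -h' else 0) t := by
  split_ifs with h1
  · refine (hh.const_sub 1).congr_of_eventuallyEq ?_
    filter_upwards [hh.continuousAt.eventually (gt_mem_nhds h1)] with s hs
    exact max_eq_right (by linarith)
  · have hmin : IsLocalMin (fun s => max 0 (1 - h s)) t := by
      refine Eventually.of_forall fun s => ?_
      simp only
      rw [max_eq_left (by linarith : 1 - h t ≤ 0)]
      exact le_max_left _ _
    have := hd.hasDerivAt
    rwa [hmin.deriv_eq_zero] at this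

namespace IsCaratheodorySolution

variable {t₀ : ℝ} {x : ℝ → Fin n → ℝ}

/-- Eventually only agents with a common limit interact. -/
theorem eventually_limit_eq (hx : IsCaratheodorySolution t₀ x) {ℓ : Fin n → ℝ}
    (hℓ : ∀ i, Tendsto (fun t => x t i) atTop (𝓝 (ℓ i))) :
    ∀ᶠ t in atTop, ∀ i j, |x t i - x t j| < 1 → ℓ i = ℓ j := by
  classical
  have hsep : ∀ i j, ℓ i < ℓ j → 1 ≤ ℓ j - ℓ i := fun i j h => hx.one_le_of_limit_lt hℓ h
  obtain ⟨ε, hε0, hε, hεn⟩ : ∃ ε : ℝ, 0 < ε ∧ ε ≤ 1 / 4 ∧ n * (2 * ε) ≤ 1 / 2 := by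
    -- Each of the n terms of the field has error at most 2ε; the total must stay within 1/2 for the
    -- integer argument.
    refine ⟨1 / (4 * (n + 1)), by positivity, ?_, ?_⟩
    · exact one_div_le_one_div_of_le (by norm_num) (by linarith [n.cast_nonneg (α := ℝ)])
    · field_simp
      linarith
  have hnear : ∀ᶠ t in atTop, ∀ i, |x t i - ℓ i| ≤ ε := by
    rw [eventually_all]
    intro i
    filter_upwards [Metric.tendsto_nhds.1 (hℓ i) ε hε0] with t ht
    exact ht.le
  have hfar : ∀ᶠ t in atTop, ∀ i j, 1 < ℓ j - ℓ i → 1 < x t j - x t i := by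
    simp only [eventually_all]
    intro i j h
    exact ((hℓ j).sub (hℓ i)).eventually (lt_mem_nhds h)
  obtain ⟨T, hT⟩ := eventually_atTop.1 (hnear.and (hfar.and (eventually_ge_atTop t₀)))
  have hT0 : t₀ ≤ T := (hT T le_rfl).2.2
  -- The potential `Φ` adds up by how much pairs with limits one apart fall short of distance one;
  -- it is positive exactly when a cross edge exists.
  let φ : Fin n → Fin n → ℝ → ℝ := fun i j t =>
    if ℓ j - ℓ i = 1 then max 0 (1 - (x t j - x t i)) else 0
  let Φ : ℝ → ℝ := fun t => ∑ i, ∑ j, φ i j t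
  have hφ0 : ∀ i j t, 0 ≤ φ i j t := by
    intro i j t
    simp only [φ]
    split_ifs
    · exact le_max_left _ _
    · exact le_rfl
  have hφac : ∀ i j a b, t₀ ≤ a → t₀ ≤ b → AbsolutelyContinuousOnInterval (φ i j) a b := by
    intro i j a b ha hb
    simp only [φ]
    split_ifs
    · have h1 : LipschitzOnWith (0 + (n + n)) (fun t => 1 - (x t j - x t i)) (Ici t₀) :=
        ((LipschitzWith.const (1 : ℝ)).lipschitzOnWith).sub ((hx.lipschitzOnWith j).sub (hx.lipschitzOnWith i))
      have h2 := (LipschitzWith.id.const_max (0 : ℝ)).comp_lipschitzOnWith h1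
      exact (h2.mono fun _ ht => (le_min ha hb).trans ht.1).absolutelyContinuousOnInterval
    · exact absolutelyContinuousOnInterval_const 0 a b
  have hΦac : ∀ a b, t₀ ≤ a → t₀ ≤ b → AbsolutelyContinuousOnInterval Φ a b := fun a b ha hb =>
    absolutelyContinuousOnInterval_sum _ fun i _ =>
      absolutelyContinuousOnInterval_sum _ fun j _ => hφac i j a b ha hb
  let D : ℝ → ℝ := fun t =>
    ∑ i, ∑ j, (crossEdge ℓ (x t) i j : ℝ) * (field (x t) i - field (x t) j)
  have hder : ∀ a b, t₀ ≤ a → a ≤ b → ∀ᵐ t, t ∈ Ioo a b → HasDerivAt Φ (D t) t := by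
    intro a b ha hab
    filter_upwards [hx.ae_hasDerivAt, ae_all_iff.2 fun i => ae_all_iff.2 fun j =>
      (hφac i j a b ha (ha.trans hab)).ae_differentiableAt] with t h1 h2 ht
    have h1 := h1 (ha.trans_lt ht.1)
    refine HasDerivAt.fun_sum fun i _ => HasDerivAt.fun_sum fun j _ => ?_
    have h2 := h2 i j (by rw [uIcc_of_le hab]; exact Ioo_subset_Icc_self ht)
    by_cases hc : ℓ j - ℓ i = 1
    · simp only [φ, hc, if_true, crossEdge, true_and] at h2 ⊢
      convert! hasDerivAt_max_zero_one_sub ((h1 j).fun_sub (h1 i)) h2 using 1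
      split_ifs <;> simp
    · simp only [φ, hc, if_false, crossEdge, false_and, Int.cast_zero, zero_mul]
      exact hasDerivAt_const t 0
  have hgrow : ∀ κ a b, T ≤ a → a ≤ b → (∀ t ∈ Ioo a b, κ ≤ D t) →
      κ * (b - a) ≤ Φ b - Φ a := by
    intro κ a b ha hab h
    have hac : AbsolutelyContinuousOnInterval (fun t => Φ t - κ * t) a b :=
      (hΦac a b (hT0.trans ha) (hT0.trans (ha.trans hab))).fun_sub
        (ContDiff.contDiffOn (by fun_prop)).absolutelyContinuousOnInterval
    have := le_of_ae_hasDerivAt_nonneg hab hac (by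
      filter_upwards [hder a b (hT0.trans ha) hab] with t h1 ht
      refine ⟨D t - κ, sub_nonneg.2 (h t ht), (h1 ht).fun_sub ?_⟩
      simpa using (hasDerivAt_id t).const_mul κ)
    linarith
  have hD : ∀ t, T ≤ t → (∃ i j, ℓ j - ℓ i = 1 ∧ x t j - x t i < 1) → 1 / 2 ≤ D t :=
    fun t ht hex => half_le_sum_crossEdge_mul hε hεn (hT t ht).1 hsep (hT t ht).2.1 hex
  have hD0 : ∀ t, T ≤ t → 0 ≤ D t := by
    intro t ht
    by_cases hex : ∃ i j, ℓ j - ℓ i = 1 ∧ x t j - x t i < 1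
    · linarith [hD t ht hex]
    · push Not at hex
      refine (Finset.sum_eq_zero fun i _ => Finset.sum_eq_zero fun j _ => ?_).ge
      have : crossEdge ℓ (x t) i j = 0 := if_neg fun h => (hex i j h.1).not_gt h.2
      simp [this]
  have hΦbd : ∀ t, T ≤ t → Φ t ≤ n * n := by
    intro t ht
    have : Φ t ≤ ∑ _i : Fin n, ∑ _j : Fin n, (1 : ℝ) := by
      refine Finset.sum_le_sum fun i _ => Finset.sum_le_sum fun j _ => ?_
      simp only [φ]
      split_ifs with hc
      · have hi := abs_le.1 ((hT t ht).1 i)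
        have hj := abs_le.1 ((hT t ht).1 j)
        exact max_le (by norm_num) (by linarith)
      · norm_num
    simpa using this
  have hΦ0 : ∀ t, 0 ≤ Φ t := fun t =>
    Finset.sum_nonneg fun i _ => Finset.sum_nonneg fun j _ => hφ0 i j t
  have hnone : ∀ t, T ≤ t → ∀ i j, ℓ j - ℓ i = 1 → 1 ≤ x t j - x t i := by
    intro t₁ ht₁ i j hij
    by_contra hlt
    rw [not_le] at hlt
    have hpos : 0 < Φ t₁ := by
      have h1 : 0 < φ i j t₁ := by
        simp only [φ, hij, if_true]
        exact lt_max_of_lt_right (by linarith)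
      exact h1.trans_le ((Finset.single_le_sum (f := fun j => φ i j t₁)
        (fun j _ => hφ0 i j t₁) (Finset.mem_univ j)).trans
        (Finset.single_le_sum (f := fun i => ∑ j, φ i j t₁)
        (fun i _ => Finset.sum_nonneg fun j _ => hφ0 i j t₁) (Finset.mem_univ i)))
    -- `Φ` never decreases after `T`, so once it is positive some cross edge is present at every
    -- later time.
    have hex : ∀ t, t₁ ≤ t → ∃ i j, ℓ j - ℓ i = 1 ∧ x t j - x t i < 1 := by
      intro t ht
      have h1 := hgrow 0 t₁ t ht₁ ht fun s hs => hD0 s (ht₁.trans hs.1.le)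
      by_contra hcon
      push Not at hcon
      have : Φ t = 0 := Finset.sum_eq_zero fun i _ => Finset.sum_eq_zero fun j _ => by
        simp only [φ]
        split_ifs with hc
        · exact max_eq_left (by linarith [hcon i j hc])
        · rfl
      linarith
    -- At rate 1/2 this duration yields a growth of n² + 1, beyond the bound n² on `Φ`.
    have h2 := hgrow (1 / 2) t₁ (t₁ + (2 * (n * n) + 2)) ht₁
      (by have : (0 : ℝ) ≤ n * n := by positivity
          linarith) fun s hs => hD s (ht₁.trans hs.1.le) (hex s hs.1.le)
    have h3 := hΦbd (t₁ + (2 * (n * n) + 2)) (ht₁.trans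
      (by have : (0 : ℝ) ≤ n * n := by positivity
          linarith))
    linarith
  have hlt : ∀ t, T ≤ t → ∀ i j, ℓ i < ℓ j → 1 ≤ x t j - x t i := by
    intro t ht i j h
    rcases (hsep i j h).lt_or_eq with h1 | h1
    · exact ((hT t ht).2.1 i j h1).le
    · exact hnone t ht i j h1.symm
  filter_upwards [eventually_ge_atTop T] with t ht i j hij
  rw [abs_lt] at hij
  rcases lt_trichotomy (ℓ i) (ℓ j) with h | h | h
  · linarith [hlt t ht i j h]
  · exact h
  · linarith [hlt t ht j i h]

theorem tendsto_localVariance (hx : IsCaratheodorySolution t₀ x) :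
    Tendsto (fun t => localVariance (x t)) atTop (𝓝 0) := by
  choose ℓ hℓ using hx.exists_tendsto
  have h0 : Tendsto (fun t => (1 / (n : ℝ)) * ∑ i, (x t i - ℓ i) ^ 2) atTop (𝓝 0) := by
    have : Tendsto (fun t => (1 / (n : ℝ)) * ∑ i, (x t i - ℓ i) ^ 2) atTop
        (𝓝 ((1 / (n : ℝ)) * ∑ i, (ℓ i - ℓ i) ^ 2)) :=
      (tendsto_finsetSum _ fun i _ => ((hℓ i).sub_const (ℓ i)).pow 2).const_mul _
    simpa using this
  refine tendsto_of_tendsto_of_tendsto_of_le_of_le' tendsto_const_nhds h0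
    (Eventually.of_forall fun t => localVariance_nonneg (x t)) ?_
  filter_upwards [hx.eventually_limit_eq hℓ] with t ht
  exact localVariance_le (x t) ℓ ht

end IsCaratheodorySolution

/-! ### Null sets of initial conditions -/

theorem dimH_fiber_le {E F : Type*} [NormedAddCommGroup E] [NormedSpace ℝ E]
    [FiniteDimensional ℝ E] [AddCommGroup F] [Module ℝ F] (L : E →ₗ[ℝ] F) (c : F) :
    dimH (L ⁻¹' {c}) ≤ Module.finrank ℝ (LinearMap.ker L) := by
  rcases (L ⁻¹' {c}).eq_empty_or_nonempty with h | ⟨p, hp⟩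
  · simp [h]
  · refine le_trans (dimH_mono ?_) (ContDiff.dimH_range_le
      (f := fun w : LinearMap.ker L => p + (w : E))
      (contDiff_const.add (LinearMap.ker L).subtypeL.contDiff))
    intro u hu
    rw [mem_preimage, mem_singleton_iff] at hu hp
    exact ⟨⟨u - p, by simp [hu, hp]⟩, by simp⟩

/-- A set that embeds by an antilipschitz map into an affine subspace of dimension less than `n`
is Lebesgue null. -/
theorem volume_eq_zero_of_antilipschitz {E F : Type*} [NormedAddCommGroup E] [NormedSpace ℝ E]
    [FiniteDimensional ℝ E] [AddCommGroup F] [Module ℝ F] (L : E →ₗ[ℝ] F)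
    (hL : Function.Surjective L) (hdim : Module.finrank ℝ E < n + Module.finrank ℝ F) (c : F)
    (S : Set (Fin n → ℝ)) (f : S → E) {K : NNReal} (hf : AntilipschitzWith K f)
    (hc : ∀ p, L (f p) = c) : volume S = 0 := by
  have hrank := L.finrank_range_add_finrank_ker
  rw [LinearMap.range_eq_top.2 hL, finrank_top] at hrank
  -- An antilipschitz map does not lower Hausdorff dimension, and the image of `S` lies in a fibre
  -- of `L`.
  have h1 : dimH S ≤ Module.finrank ℝ (LinearMap.ker L) := by
    calc dimH S = dimH ((↑) '' (univ : Set S) : Set (Fin n → ℝ)) := by simp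
      _ = dimH (univ : Set S) := isometry_subtype_coe.dimH_image _
      _ ≤ dimH (f '' univ) := hf.le_dimH_image _
      _ ≤ dimH (L ⁻¹' {c}) := dimH_mono (by rintro _ ⟨p, -, rfl⟩; exact hc p)
      _ ≤ _ := dimH_fiber_le L c
  have h2 : dimH S < ((n : NNReal) : ENNReal) := by
    refine h1.trans_lt ?_
    have : Module.finrank ℝ (LinearMap.ker L) < n := by omega
    exact_mod_cast this
  refine measure_zero_of_dimH_lt (d := (n : NNReal)) ?_ h2
  have := hausdorffMeasure_pi_real (ι := Fin n)
  rw [Fintype.card_fin] at this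
  rw [NNReal.coe_natCast, this]

theorem surjective_prod_of_ne_zero {E : Type*} [AddCommGroup E] [Module ℝ E] (f g : E →ₗ[ℝ] ℝ)
    {u v : E} (hu : f u ≠ 0) (hv : f v = 0) (hv' : g v ≠ 0) :
    Function.Surjective (f.prod g) := by
  rintro ⟨p, q⟩
  refine ⟨(p / f u) • u + ((q - p / f u * g u) / g v) • v, ?_⟩
  refine Prod.ext ?_ ?_
  · change f _ = p
    simp only [map_add, map_smul, smul_eq_mul, hv]
    field_simp
    ring
  · change g _ = q
    simp only [map_add, map_smul, smul_eq_mul]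
    field_simp
    ring

theorem exists_first_eq_one {f : ℝ → ℝ} {a b : ℝ} (hab : a ≤ b) (hf : ContinuousOn f (Icc a b))
    (ha : f a < 1) (hb : 1 ≤ f b) :
    ∃ s ∈ Ioc a b, f s = 1 ∧ ∀ u ∈ Ico a s, f u < 1 := by
  have hcpt : IsCompact (Icc a b ∩ f ⁻¹' {1}) :=
    isCompact_Icc.of_isClosed_subset (hf.preimage_isClosed_of_isClosed isClosed_Icc
      isClosed_singleton) inter_subset_left
  obtain ⟨s, ⟨hs, hs1⟩, hmin⟩ := hcpt.exists_isLeast (by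
    obtain ⟨s, hs, h⟩ := intermediate_value_Icc hab hf (show (1 : ℝ) ∈ Icc _ _ from ⟨ha.le, hb⟩)
    exact ⟨s, hs, h⟩)
  rw [mem_preimage, mem_singleton_iff] at hs1
  refine ⟨s, ⟨hs.1.lt_of_ne fun h => by rw [h, hs1] at ha; exact lt_irrefl _ ha, hs.2⟩, hs1, ?_⟩
  intro u hu
  by_contra hcon
  obtain ⟨r, hr, h⟩ := intermediate_value_Icc hu.1
    (hf.mono (Icc_subset_Icc_right (hu.2.le.trans hs.2)))
    (show (1 : ℝ) ∈ Icc _ _ from ⟨ha.le, not_lt.1 hcon⟩)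
  have := hmin ⟨⟨hr.1, hr.2.trans (hu.2.le.trans hs.2)⟩, h⟩
  linarith [hr.2, hu.2]

theorem exists_last_eq_one {f : ℝ → ℝ} {a b : ℝ} (hab : a ≤ b) (hf : ContinuousOn f (Icc a b))
    (ha : 1 ≤ f a) (hb : f b < 1) :
    ∃ s ∈ Ico a b, f s = 1 ∧ ∀ u ∈ Ioc s b, f u < 1 := by
  obtain ⟨s, hs, h1, h2⟩ := exists_first_eq_one (f := fun u => f (-u)) (neg_le_neg hab)
    (hf.comp continuous_neg.continuousOn fun u hu =>
      ⟨by linarith [hu.2], by linarith [hu.1]⟩) (by simpa using hb) (by simpa using ha)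
  refine ⟨-s, ⟨by linarith [hs.2], by linarith [hs.1]⟩, h1, fun u hu => ?_⟩
  simpa using h2 (-u) ⟨by linarith [hu.2], by linarith [hu.1]⟩

namespace IsCaratheodorySolution

variable {t₀ : ℝ} {x y : ℝ → Fin n → ℝ}

theorem dist_le (hx : IsCaratheodorySolution t₀ x) (hy : IsCaratheodorySolution t₀ y)
    {s t : ℝ} (hs : t₀ ≤ s) (hst : s ≤ t) :
    dist (x s) (y s) ≤ Real.exp (n * (t - s)) * Real.sqrt n * dist (x t) (y t) := by
  refine (dist_pi_le_iff (by positivity)).2 fun i => ?_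
  rw [Real.dist_eq]
  refine abs_le_of_sq_le_sq ?_ (by positivity)
  have h1 := hx.sum_sq_sub_le hy hs hst
  have h2 : (x s i - y s i) ^ 2 ≤ ∑ i, (x s i - y s i) ^ 2 :=
    Finset.single_le_sum (f := fun i => (x s i - y s i) ^ 2) (fun i _ => sq_nonneg _)
      (Finset.mem_univ i)
  have h3 : ∑ i, (x t i - y t i) ^ 2 ≤ n * dist (x t) (y t) ^ 2 := by
    have : ∑ i, (x t i - y t i) ^ 2 ≤ ∑ _i : Fin n, dist (x t) (y t) ^ 2 := by
      refine Finset.sum_le_sum fun i _ => sq_le_sq.2 ?_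
      rw [abs_of_nonneg (dist_nonneg (x := x t) (y := y t)), ← Real.dist_eq]
      exact dist_le_pi_dist (x t) (y t) i
    simpa using this
  have h4 : (Real.exp (n * (t - s)) * Real.sqrt n * dist (x t) (y t)) ^ 2 =
      Real.exp (2 * n * (t - s)) * (n * dist (x t) (y t) ^ 2) := by
    rw [mul_pow, mul_pow, Real.sq_sqrt (by positivity), ← Real.exp_nat_mul]
    push_cast
    ring_nf
  rw [h4]
  exact h2.trans (h1.trans (mul_le_mul_of_nonneg_left h3 (Real.exp_pos _).le))

theorem dist_time_le (hx : IsCaratheodorySolution t₀ x) {s t : ℝ} (hs : t₀ ≤ s) (ht : t₀ ≤ t) :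
    dist (x s) (x t) ≤ n * dist s t := by
  refine (dist_pi_le_iff (by positivity)).2 fun i => ?_
  simpa using (hx.lipschitzOnWith i).dist_le_mul s hs t ht

/-- The initial position depends in a Lipschitz way on the time and place of arrival. -/
theorem dist_initial_le (hx : IsCaratheodorySolution t₀ x) (hy : IsCaratheodorySolution t₀ y)
    {R s r : ℝ} (hs : t₀ ≤ s) (hsR : s ≤ t₀ + R) (hr : t₀ ≤ r) (hrR : r ≤ t₀ + R) :
    dist (x t₀) (y t₀) ≤
      (n + Real.exp (n * R) * Real.sqrt n) * dist (s, x s) (r, y r) := by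
  wlog hrs : r ≤ s generalizing x y s r
  · rw [dist_comm (x t₀), dist_comm (s, x s)]
    exact this hy hx hr hrR hs hsR (le_of_not_ge hrs)
  -- Dropping the first s - r units of time of `x` makes both trajectories last r - t₀; the backward
  -- estimate then applies, and the dropped piece costs at most n(s - r).
  have hz := hx.shift (sub_nonneg.2 hrs)
  have h1 := hz.dist_le hy le_rfl hr
  have h2 := hx.dist_time_le (s := t₀) (t := t₀ + (s - r)) le_rfl (by linarith)
  have h3 : dist t₀ (t₀ + (s - r)) = dist s r := by
    rw [Real.dist_eq, Real.dist_eq, abs_sub_comm]; ring_nf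
  rw [add_sub_cancel r s] at h1
  have h4 : dist s r ≤ dist (s, x s) (r, y r) := le_max_left _ _
  have h5 : dist (x s) (y r) ≤ dist (s, x s) (r, y r) := le_max_right _ _
  have h6 : Real.exp (n * (r - t₀)) ≤ Real.exp (n * R) :=
    Real.exp_le_exp.2 (mul_le_mul_of_nonneg_left (by linarith) n.cast_nonneg)
  have h7 : Real.exp (n * (r - t₀)) * Real.sqrt n * dist (x s) (y r) ≤
      Real.exp (n * R) * Real.sqrt n * dist (s, x s) (r, y r) := by gcongr
  have h8 : (n : ℝ) * dist s r ≤ n * dist (s, x s) (r, y r) := by gcongr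
  rw [h3] at h2
  have := dist_triangle (x t₀) (x (t₀ + (s - r))) (y t₀)
  linarith

end IsCaratheodorySolution

/-- Almost every initial condition leads off a given hyperplane at a given time. -/
theorem ae_forall_solution_ne (t₀ : ℝ) {q : ℝ} (hq : t₀ ≤ q) (L : (Fin n → ℝ) →ₗ[ℝ] ℝ)
    (hL : Function.Surjective L) (c : ℝ) :
    ∀ᵐ x₀ : Fin n → ℝ, ∀ x, IsCaratheodorySolution t₀ x → x t₀ = x₀ → L (x q) ≠ c := by
  rw [ae_iff]
  push Not
  set S : Set (Fin n → ℝ) := {x₀ | ∃ x, IsCaratheodorySolution t₀ x ∧ x t₀ = x₀ ∧ L (x q) = c}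
  choose X hX hX0 hXc using fun p : S => p.2
  refine volume_eq_zero_of_antilipschitz L hL (by simp) c S (fun p => X p q)
    (K := ⟨Real.exp (n * (q - t₀)) * Real.sqrt n, by positivity⟩) ?_ hXc
  refine AntilipschitzWith.of_le_mul_dist fun p p' => ?_
  rw [Subtype.dist_eq, ← hX0 p, ← hX0 p']
  exact (hX p).dist_le (hX p') le_rfl hq

/-- Almost every initial condition never leads to a given affine subspace of codimension two. -/
theorem ae_forall_solution_forall_ne (t₀ : ℝ) (L : (Fin n → ℝ) →ₗ[ℝ] ℝ × ℝ)
    (hL : Function.Surjective L) (c : ℝ × ℝ) :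
    ∀ᵐ x₀ : Fin n → ℝ, ∀ x, IsCaratheodorySolution t₀ x → x t₀ = x₀ →
      ∀ s, t₀ ≤ s → L (x s) ≠ c := by
  have key : ∀ R : ℕ, ∀ᵐ x₀ : Fin n → ℝ, ∀ x, IsCaratheodorySolution t₀ x → x t₀ = x₀ →
      ∀ s, t₀ ≤ s → s ≤ t₀ + R → L (x s) ≠ c := by
    intro R
    rw [ae_iff]
    push Not
    set S : Set (Fin n → ℝ) := {x₀ | ∃ x, IsCaratheodorySolution t₀ x ∧ x t₀ = x₀ ∧
      ∃ s, t₀ ≤ s ∧ s ≤ t₀ + R ∧ L (x s) = c}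
    choose X hX hX0 s hs hsR hXc using fun p : S => p.2
    -- The unknown arrival time adds one dimension: space-time has dimension n + 1, so codimension
    -- two is needed.
    refine volume_eq_zero_of_antilipschitz (L ∘ₗ LinearMap.snd ℝ ℝ (Fin n → ℝ))
      (hL.comp Prod.snd_surjective) (by simp; omega) c S (fun p => (s p, X p (s p)))
      (K := ⟨n + Real.exp (n * R) * Real.sqrt n, by positivity⟩) ?_ hXc
    refine AntilipschitzWith.of_le_mul_dist fun p p' => ?_
    rw [Subtype.dist_eq, ← hX0 p, ← hX0 p']
    exact (hX p).dist_initial_le (hX p') (hs p) (hsR p) (hs p') (hsR p')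
  filter_upwards [ae_all_iff.2 key] with x₀ h x hx h0 s hs
  obtain ⟨R, hR⟩ := exists_nat_ge (s - t₀)
  exact h R x hx h0 s hs (by linarith)

/-! ### Generic trajectories -/

/-- The signed gap from agent `i` to agent `j`. -/
noncomputable def gap (i j : Fin n) : (Fin n → ℝ) →ₗ[ℝ] ℝ :=
  LinearMap.proj (R := ℝ) (φ := fun _ : Fin n => ℝ) j - LinearMap.proj i

@[simp] theorem gap_apply (i j : Fin n) (x : Fin n → ℝ) : gap i j x = x j - x i := rfl

/-- The rate at which the agents of `J` and `I` pull agents `j` and `i` apart. -/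
noncomputable def spread (i j : Fin n) (I J : Finset (Fin n)) : (Fin n → ℝ) →ₗ[ℝ] ℝ :=
  ∑ m ∈ J, gap j m - ∑ m ∈ I, gap i m

theorem spread_apply (i j : Fin n) (I J : Finset (Fin n)) (x : Fin n → ℝ) :
    spread i j I J x = ∑ m ∈ J, (x m - x j) - ∑ m ∈ I, (x m - x i) := by
  simp [spread, LinearMap.sub_apply, LinearMap.sum_apply]

theorem surjective_gap {i j : Fin n} (h : i ≠ j) : Function.Surjective (gap i j) := by
  intro c
  exact ⟨Pi.single j c, by simp [h]⟩

theorem surjective_gap_prod_gap {i j a b : Fin n} (hij : i ≠ j) (hab : a ≠ b)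
    (h1 : ¬(a = i ∧ b = j)) (h2 : ¬(a = j ∧ b = i)) :
    Function.Surjective ((gap i j).prod (gap a b)) := by
  have hu : gap i j (Pi.single j 1) ≠ 0 := by simp [hij]
  by_cases ha : a = i ∨ a = j
  · have hbi : b ≠ i := by rintro rfl; grind
    have hbj : b ≠ j := by rintro rfl; grind
    exact surjective_prod_of_ne_zero _ _ hu (v := Pi.single b 1)
      (by simp [hbi.symm, hbj.symm]) (by simp [hab])
  · push Not at ha
    exact surjective_prod_of_ne_zero _ _ hu (v := Pi.single a 1)
      (by simp [ha.1.symm, ha.2.symm]) (by simp [hab.symm])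

theorem surjective_gap_prod_spread {i j m : Fin n} (hij : i ≠ j) (hmi : m ≠ i) (hmj : m ≠ j)
    {I J : Finset (Fin n)} (h : ¬(m ∈ I ↔ m ∈ J)) :
    Function.Surjective ((gap i j).prod (spread i j I J)) := by
  have hu : gap i j (Pi.single j 1) ≠ 0 := by simp [hij]
  refine surjective_prod_of_ne_zero _ _ hu (v := Pi.single m 1)
    (by simp [hmi.symm, hmj.symm]) ?_
  rw [spread_apply]
  by_cases h1 : m ∈ I <;> by_cases h2 : m ∈ J <;>
    simp [h1, h2, hmi.symm, hmj.symm, Pi.single_apply] at h ⊢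

/-- A trajectory that meets the discontinuities of the field only in general position. -/
structure IsGeneric (t₀ : ℝ) (x : ℝ → Fin n → ℝ) : Prop where
  ne : ∀ i j, i ≠ j → x t₀ j - x t₀ i ≠ 0
  initial : ∀ i j, i ≠ j → x t₀ j - x t₀ i ≠ 1
  rational : ∀ q : ℚ, t₀ ≤ q → ∀ i j, i ≠ j → x q j - x q i ≠ 1
  pairs : ∀ i j a b : Fin n, i ≠ j → a ≠ b → ¬(a = i ∧ b = j) → ¬(a = j ∧ b = i) →
    ∀ s, t₀ ≤ s → x s j - x s i = 1 → x s b - x s a ≠ 1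
  tangency : ∀ i j m : Fin n, ∀ I J : Finset (Fin n), i ≠ j → m ≠ i → m ≠ j →
    ¬(m ∈ I ↔ m ∈ J) → ∀ s, t₀ ≤ s → x s j - x s i = 1 → spread i j I J (x s) ≠ 2

/-- Conditions at the initial time or at a rational time exclude hyperplanes, countably many in all;
conditions at arbitrary times exclude subspaces of codimension two. -/
theorem ae_isGeneric (t₀ : ℝ) : ∀ᵐ x₀ : Fin n → ℝ, ∀ x, IsCaratheodorySolution t₀ x →
    x t₀ = x₀ → IsGeneric t₀ x := by
  have h1 : ∀ᵐ x₀ : Fin n → ℝ, ∀ i j : Fin n, i ≠ j → ∀ x, IsCaratheodorySolution t₀ x →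
      x t₀ = x₀ → gap i j (x t₀) ≠ 0 := by
    simp only [eventually_all]
    exact fun i j h => ae_forall_solution_ne t₀ le_rfl _ (surjective_gap h) 0
  have h2 : ∀ᵐ x₀ : Fin n → ℝ, ∀ i j : Fin n, i ≠ j → ∀ x, IsCaratheodorySolution t₀ x →
      x t₀ = x₀ → gap i j (x t₀) ≠ 1 := by
    simp only [eventually_all]
    exact fun i j h => ae_forall_solution_ne t₀ le_rfl _ (surjective_gap h) 1
  have h3 : ∀ᵐ x₀ : Fin n → ℝ, ∀ q : ℚ, t₀ ≤ q → ∀ i j : Fin n, i ≠ j →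
      ∀ x, IsCaratheodorySolution t₀ x → x t₀ = x₀ → gap i j (x q) ≠ 1 := by
    rw [ae_all_iff]
    intro q
    simp only [eventually_all]
    exact fun hq i j h => ae_forall_solution_ne t₀ hq _ (surjective_gap h) 1
  have h4 : ∀ᵐ x₀ : Fin n → ℝ, ∀ i j a b : Fin n, i ≠ j → a ≠ b → ¬(a = i ∧ b = j) →
      ¬(a = j ∧ b = i) → ∀ x, IsCaratheodorySolution t₀ x → x t₀ = x₀ →
      ∀ s, t₀ ≤ s → (gap i j).prod (gap a b) (x s) ≠ (1, 1) := by
    simp only [eventually_all]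
    exact fun i j a b hij hab h h' =>
      ae_forall_solution_forall_ne t₀ _ (surjective_gap_prod_gap hij hab h h') _
  have h5 : ∀ᵐ x₀ : Fin n → ℝ, ∀ i j m : Fin n, ∀ I J : Finset (Fin n), i ≠ j → m ≠ i → m ≠ j →
      ¬(m ∈ I ↔ m ∈ J) → ∀ x, IsCaratheodorySolution t₀ x → x t₀ = x₀ →
      ∀ s, t₀ ≤ s → (gap i j).prod (spread i j I J) (x s) ≠ (1, 2) := by
    simp only [eventually_all]
    exact fun i j m I J hij hi hj h =>
      ae_forall_solution_forall_ne t₀ _ (surjective_gap_prod_spread hij hi hj h) _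
  filter_upwards [h1, h2, h3, h4, h5] with x₀ h1 h2 h3 h4 h5 x hx h0
  refine ⟨fun i j h => h1 i j h x hx h0, fun i j h => h2 i j h x hx h0,
    fun q hq i j h => h3 q hq i j h x hx h0, ?_, ?_⟩
  · intro i j a b hij hab h h' s hs e1 e2
    exact h4 i j a b hij hab h h' x hx h0 s hs (Prod.ext e1 e2)
  · intro i j m I J hij hi hj h s hs e1 e2
    exact h5 i j m I J hij hi hj h x hx h0 s hs (Prod.ext e1 e2)

/-! ### Along generic trajectories clusters only split -/

namespace IsCaratheodorySolution

variable {t₀ : ℝ} {x : ℝ → Fin n → ℝ}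

theorem lt_iff (hx : IsCaratheodorySolution t₀ x) (hg : IsGeneric t₀ x) {i j : Fin n} {t : ℝ}
    (ht : t₀ ≤ t) : x t i < x t j ↔ x t₀ i < x t₀ j := by
  refine ⟨fun h => ?_, hx.lt_of_lt le_rfl ht⟩
  by_contra hcon
  have hne : x t₀ j ≠ x t₀ i := by
    have hij : i ≠ j := by rintro rfl; exact lt_irrefl _ h
    exact sub_ne_zero.1 (hg.ne i j hij)
  exact h.not_gt (hx.lt_of_lt le_rfl ht (lt_of_le_of_ne (not_lt.1 hcon) hne))

theorem continuousAt (hx : IsCaratheodorySolution t₀ x) (i : Fin n) {s : ℝ} (hs : t₀ < s) :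
    ContinuousAt (fun t => x t i) s := (hx.continuousOn i).continuousAt (Ici_mem_nhds hs)

theorem gap_mono (hx : IsCaratheodorySolution t₀ x) (i j : Fin n) {a b : ℝ} (ha : t₀ ≤ a)
    (hab : a ≤ b) (h : ∀ t ∈ Ioo a b, 0 ≤ field (x t) j - field (x t) i) :
    x a j - x a i ≤ x b j - x b i := by
  have hb := ha.trans hab
  have e : x b j - x b i - (x a j - x a i) =
      ∫ t in a..b, (field (x t) j - field (x t) i) := by
    rw [intervalIntegral.integral_sub (hx.intervalIntegrable j ha hb)
      (hx.intervalIntegrable i ha hb), ← hx.sub_eq_integral j ha hb, ← hx.sub_eq_integral i ha hb]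
    ring
  have h0 : 0 ≤ ∫ t in a..b, (field (x t) j - field (x t) i) := by
    apply intervalIntegral.integral_nonneg_of_ae_restrict hab
    rw [← restrict_Ioo_eq_restrict_Icc]
    exact (ae_restrict_iff' measurableSet_Ioo).2 (Eventually.of_forall h)
  linarith

open scoped Classical in
/-- Close to a time at which `i` and `j` are the only agents at distance one, the speed of the gap
is the spread due to the other agents minus the mutual attraction. -/
theorem eventually_field_sub_eq (hx : IsCaratheodorySolution t₀ x) (hg : IsGeneric t₀ x)
    {i j : Fin n} (hij : i ≠ j) {s : ℝ} (hs : t₀ < s) (h1 : x s j - x s i = 1) :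
    ∀ᶠ t in 𝓝 s, field (x t) j - field (x t) i =
      spread i j {m | |x s i - x s m| < 1} {m | |x s j - x s m| < 1} (x t) -
        2 * pull (x t j - x t i) := by
  have hne : ∀ a b, ¬(a = i ∧ b = j) → ¬(a = j ∧ b = i) → |x s a - x s b| ≠ 1 := by
    intro a b h h' hab
    rcases eq_or_ne a b with rfl | hne
    · simp at hab
    · rcases abs_eq_abs.1 (hab.trans abs_one.symm) with e | e
      · exact hg.pairs i j b a hij hne.symm (by tauto) (by tauto) s hs.le h1 e
      · exact hg.pairs i j a b hij hne h h' s hs.le h1 (by linarith)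
  have hev : ∀ᶠ t in 𝓝 s, ∀ a b, ¬(a = i ∧ b = j) → ¬(a = j ∧ b = i) →
      (|x t a - x t b| < 1 ↔ |x s a - x s b| < 1) := by
    simp only [eventually_all]
    intro a b h h'
    have hc : ContinuousAt (fun t => |x t a - x t b|) s :=
      ((hx.continuousAt a hs).sub (hx.continuousAt b hs)).abs
    rcases lt_or_gt_of_ne (hne a b h h') with hlt | hgt
    · filter_upwards [hc.eventually (gt_mem_nhds hlt)] with t ht
      exact ⟨fun _ => hlt, fun _ => ht⟩
    · filter_upwards [hc.eventually (lt_mem_nhds hgt)] with t ht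
      exact ⟨fun h => absurd h (not_lt.2 ht.le), fun h => absurd h (not_lt.2 hgt.le)⟩
  filter_upwards [hev] with t ht
  have hf : ∀ k l, |x s k - x s l| = 1 →
      (∀ m, m ≠ l → (|x t k - x t m| < 1 ↔ |x s k - x s m| < 1)) →
      field (x t) k = ∑ m with |x s k - x s m| < 1, (x t m - x t k) - pull (x t k - x t l) := by
    intro k l hkl hm
    have e : pull (x t k - x t l) = ∑ m, if m = l then pull (x t k - x t m) else 0 := by simp
    rw [field_eq_sum_pull, Finset.sum_filter, eq_sub_iff_add_eq, ← Finset.sum_neg_distrib, e,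
      ← Finset.sum_add_distrib]
    refine Finset.sum_congr rfl fun m _ => ?_
    by_cases hml : m = l
    · subst hml; simp [hkl]
    · by_cases h : |x s k - x s m| < 1
      · rw [pull_of_lt ((hm m hml).2 h), if_pos h, if_neg hml]; ring
      · rw [pull_of_le (not_lt.1 (mt (hm m hml).1 h)), if_neg h, if_neg hml]; ring
  have ej := hf j i (by rw [h1, abs_one]) fun m hm =>
    ht j m (fun h => hij h.1.symm) (fun h => hm h.2)
  have ei := hf i j (by rw [abs_sub_comm, h1, abs_one]) fun m hm =>
    ht i m (fun h => hm h.2) (fun h => hij h.1)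
  rw [ej, ei, spread_apply, ← neg_sub (x t j) (x t i), pull_neg]
  ring

/-- Along a generic trajectory, consecutive agents that do not interact never start to. -/
theorem one_le_gap (hx : IsCaratheodorySolution t₀ x) (hg : IsGeneric t₀ x) {i j : Fin n}
    (hij : x t₀ i < x t₀ j) (hcons : ∀ m, ¬(x t₀ i < x t₀ m ∧ x t₀ m < x t₀ j)) {r t : ℝ}
    (hr : t₀ ≤ r) (hrt : r ≤ t) (h : 1 ≤ x r j - x r i) : 1 ≤ x t j - x t i := by
  classical
  by_contra hlt
  rw [not_le] at hlt
  have hne : i ≠ j := by rintro rfl; exact lt_irrefl _ hij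
  have hcont : ContinuousOn (fun t => x t j - x t i) (Ici t₀) :=
    (hx.continuousOn j).sub (hx.continuousOn i)
  obtain ⟨s, hs, h1, hafter⟩ := exists_last_eq_one hrt
    (hcont.mono fun u hu => hr.trans hu.1) h hlt
  have hs0 : t₀ < s := (hr.trans hs.1).lt_of_ne fun e => hg.initial i j hne (e ▸ h1)
  set I : Finset (Fin n) := {m | |x s i - x s m| < 1} with hI
  set J : Finset (Fin n) := {m | |x s j - x s m| < 1} with hJ
  have hmJ : ∀ m ∈ J, m ≠ j → x t₀ j < x t₀ m := by
    intro m hm hmj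
    rw [hJ, Finset.mem_filter_univ, abs_lt] at hm
    by_contra hcon
    have h2 : x t₀ m < x t₀ j :=
      lt_of_le_of_ne (not_lt.1 hcon) (sub_ne_zero.1 (hg.ne j m hmj.symm))
    have h3 : x t₀ m ≤ x t₀ i := not_lt.1 fun h4 => hcons m ⟨h4, h2⟩
    have h5 : x s m ≤ x s i := not_lt.1 fun h6 => h3.not_gt ((hx.lt_iff hg hs0.le).1 h6)
    linarith [hm.2]
  have hmI : ∀ m ∈ I, m ≠ i → x t₀ m < x t₀ i := by
    intro m hm hmi
    rw [hI, Finset.mem_filter_univ, abs_lt] at hm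
    by_contra hcon
    have h2 : x t₀ i < x t₀ m :=
      lt_of_le_of_ne (not_lt.1 hcon) (sub_ne_zero.1 (hg.ne m i hmi))
    have h3 : x t₀ j ≤ x t₀ m := not_lt.1 fun h4 => hcons m ⟨h2, h4⟩
    have h5 : x s j ≤ x s m := not_lt.1 fun h6 => h3.not_gt ((hx.lt_iff hg hs0.le).1 h6)
    linarith [hm.1]
  have hv0 : ∀ τ, t₀ ≤ τ → 0 ≤ spread i j I J (x τ) := by
    intro τ hτ
    have e1 : 0 ≤ ∑ m ∈ J, (x τ m - x τ j) := Finset.sum_nonneg fun m hm => by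
      rcases eq_or_ne m j with rfl | hmj
      · simp
      · exact sub_nonneg.2 ((hx.lt_iff hg hτ).2 (hmJ m hm hmj)).le
    have e2 : ∑ m ∈ I, (x τ m - x τ i) ≤ 0 := Finset.sum_nonpos fun m hm => by
      rcases eq_or_ne m i with rfl | hmi
      · simp
      · exact sub_nonpos.2 ((hx.lt_iff hg hτ).2 (hmI m hm hmi)).le
    rw [spread_apply]
    linarith
  -- At gaps just below one the speed is close to the spread minus 2, so 2 is the critical value.
  have hv2 : spread i j I J (x s) ≠ 2 := by
    intro hv
    by_cases hex : ∃ m, m ≠ i ∧ m ≠ j ∧ ¬(m ∈ I ↔ m ∈ J)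
    · obtain ⟨m, hmi, hmj, hm⟩ := hex
      exact hg.tangency i j m I J hne hmi hmj hm s hs0.le h1 hv
    -- Other neighbours of j lie above j and those of i below i. If `I` and `J` agree away from i
    -- and j, there are none, and the spread is 0.
    · push Not at hex
      have e1 : ∑ m ∈ J, (x s m - x s j) = 0 := Finset.sum_eq_zero fun m hm => by
        rcases eq_or_ne m j with rfl | hmj
        · simp
        · have h2 := hmJ m hm hmj
          have hmi : m ≠ i := by rintro rfl; exact h2.not_gt hij
          exact absurd (hmI m ((hex m hmi hmj).2 hm) hmi) (hij.trans h2).not_gt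
      have e2 : ∑ m ∈ I, (x s m - x s i) = 0 := Finset.sum_eq_zero fun m hm => by
        rcases eq_or_ne m i with rfl | hmi
        · simp
        · have h2 := hmI m hm hmi
          have hmj : m ≠ j := by rintro rfl; exact h2.not_gt hij
          exact absurd (hmJ m ((hex m hmi hmj).1 hm) hmj) (h2.trans hij).not_gt
      rw [spread_apply, e1, e2] at hv
      norm_num at hv
  have hvc : ContinuousAt (fun τ => spread i j I J (x τ)) s :=
    (spread i j I J).continuous_of_finiteDimensional.continuousAt.comp
      (continuousAt_pi.2 fun k => hx.continuousAt k hs0)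
  have hgc : ContinuousAt (fun τ => x τ j - x τ i) s :=
    (hx.continuousAt j hs0).sub (hx.continuousAt i hs0)
  have hfield := hx.eventually_field_sub_eq hg hne hs0 h1
  rcases lt_or_gt_of_ne hv2 with hlow | hhigh
  -- Subcritical spread: near s a gap below one would shrink and could not return to 1 at s. So the
  -- gap is at least one just before s.
  · have hev : ∀ᶠ τ in 𝓝 s, spread i j I J (x τ) < 2 * (x τ j - x τ i) :=
      hvc.eventually_lt (hgc.const_mul 2) (by simpa only [h1, mul_one] using hlow)
    obtain ⟨a, ha, hl⟩ := exists_Ioc_subset_of_mem_nhds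
      ((hfield.and hev).and (Ioi_mem_nhds hs0)) ⟨t₀, hs0⟩
    have hge : ∀ τ ∈ Ioc a s, 1 ≤ x τ j - x τ i := by
      intro τ hτ
      by_contra hcon
      obtain ⟨σ, hσ, hσ1, hbefore⟩ := exists_first_eq_one hτ.2
        (hcont.mono fun u hu => (hl ⟨hτ.1.trans_le hu.1, hu.2⟩).2.le) (not_le.1 hcon) h1.ge
      have := hx.gap_mono j i (a := τ) (b := σ) (hl hτ).2.le hσ.1.le fun u hu => by
        have hu' : u ∈ Ioc a s := ⟨hτ.1.trans hu.1, hu.2.le.trans hσ.2⟩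
        obtain ⟨⟨e1, e2⟩, e3⟩ := hl hu'
        have e4 := hbefore u ⟨hu.1.le, hu.2⟩
        have e5 : x u i < x u j := (hx.lt_iff hg (le_of_lt e3)).2 hij
        rw [pull_of_lt (abs_lt.2 ⟨by linarith, e4⟩)] at e1
        linarith
      linarith [not_le.1 hcon]
    -- Without mutual attraction the gap is nondecreasing up to its value 1 at s, so it equals 1 on
    -- a whole interval, which contains a rational time.
    obtain ⟨q, hq1, hq2⟩ := exists_rat_btwn ha
    have hq : (q : ℝ) ∈ Ioc a s := ⟨hq1, hq2.le⟩
    refine hg.rational q (hl hq).2.le i j hne (le_antisymm ?_ (hge q hq))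
    rw [← h1]
    refine hx.gap_mono i j (hl hq).2.le hq2.le fun u hu => ?_
    have hu' : u ∈ Ioc a s := ⟨hq1.trans hu.1, hu.2.le⟩
    obtain ⟨⟨e1, -⟩, e3⟩ := hl hu'
    rw [e1, pull_of_le ((hge u hu').trans (le_abs_self _))]
    linarith [hv0 u (le_of_lt e3)]
  -- Supercritical spread: the other agents outweigh the mutual attraction, so the gap cannot drop
  -- below one just after s.
  · obtain ⟨b, hb, hu⟩ := exists_Ico_subset_of_mem_nhds
      (hfield.and (hvc.eventually (lt_mem_nhds hhigh))) ⟨t, hs.2⟩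
    obtain ⟨c, hc1, hc2⟩ := exists_between (lt_min hb hs.2)
    have := hx.gap_mono i j hs0.le hc1.le fun u hu' => by
      obtain ⟨e1, e2⟩ := hu ⟨hu'.1.le, hu'.2.trans (hc2.trans_le (min_le_left _ _))⟩
      rw [e1]
      have := (le_abs_self _).trans (abs_pull_le (x u j - x u i))
      linarith
    have h2 := hafter c ⟨hc1, hc2.le.trans (min_le_right _ _)⟩
    linarith

/-- Along a generic trajectory, agents in a common cluster were so at all earlier times. -/
theorem reachable_of_lt (hx : IsCaratheodorySolution t₀ x) (hg : IsGeneric t₀ x) {s t : ℝ}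
    (hs : t₀ ≤ s) (hst : s ≤ t) (i j : Fin n) (hij : x t i < x t j) (h : x t j - x t i < 1) :
    (interactionGraph (x s)).Reachable i j := by
  classical
  -- Strong induction on the number of agents strictly between i and j reduces to consecutive
  -- agents, where `one_le_gap` applies.
  induction hN : (Finset.univ.filter fun m => x t i < x t m ∧ x t m < x t j).card
    using Nat.strong_induction_on generalizing i j with
  | _ N ih =>
  have ht := hs.trans hst
  by_cases hex : ∃ m, x t i < x t m ∧ x t m < x t j
  · obtain ⟨m, h1, h2⟩ := hex
    have hm : m ∈ Finset.univ.filter fun m => x t i < x t m ∧ x t m < x t j := by simp [h1, h2]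
    refine (ih _ ?_ i m h1 (by linarith) rfl).trans (ih _ ?_ m j h2 (by linarith) rfl)
    · rw [← hN]
      refine Finset.card_lt_card (Finset.ssubset_iff_of_subset ?_ |>.2 ⟨m, hm, by simp⟩)
      intro k hk
      simp only [Finset.mem_filter_univ] at hk ⊢
      exact ⟨hk.1, hk.2.trans h2⟩
    · rw [← hN]
      refine Finset.card_lt_card (Finset.ssubset_iff_of_subset ?_ |>.2 ⟨m, hm, by simp⟩)
      intro k hk
      simp only [Finset.mem_filter_univ] at hk ⊢
      exact ⟨h1.trans hk.1, hk.2⟩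
  · have hij0 := (hx.lt_iff hg ht).1 hij
    refine reachable_of_abs_lt ?_
    have hlt : x s j - x s i < 1 := by
      by_contra hcon
      refine h.not_ge (hx.one_le_gap hg hij0 (fun m hm => hex ⟨m, ?_, ?_⟩) hs hst (not_lt.1 hcon))
      · exact (hx.lt_iff hg ht).2 hm.1
      · exact (hx.lt_iff hg ht).2 hm.2
    have := (hx.lt_iff hg hs).2 hij0
    rw [abs_lt]
    constructor <;> linarith

theorem reachable_of_abs_lt (hx : IsCaratheodorySolution t₀ x) (hg : IsGeneric t₀ x) {s t : ℝ}
    (hs : t₀ ≤ s) (hst : s ≤ t) {i j : Fin n} (h : |x t i - x t j| < 1) :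
    (interactionGraph (x s)).Reachable i j := by
  rw [abs_lt] at h
  rcases lt_trichotomy (x t i) (x t j) with hlt | heq | hgt
  · exact hx.reachable_of_lt hg hs hst i j hlt (by linarith)
  · have hij : i = j := by
      by_contra hne
      exact hx.ne_of_ne le_rfl (hs.trans hst)
        (fun e => hg.ne i j hne (sub_eq_zero.2 e.symm)) heq
    exact hij ▸ SimpleGraph.Reachable.refl i
  · exact (hx.reachable_of_lt hg hs hst j i hgt (by linarith)).symm

/-- Freezing the cluster means at time s avoids tracking how means change at splittings: the
deviation from them does not increase, and at time t it dominates the local variance. -/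
theorem antitoneOn_localVariance (hx : IsCaratheodorySolution t₀ x) (hg : IsGeneric t₀ x) :
    AntitoneOn (fun t => localVariance (x t)) (Ici t₀) := by
  intro s hs t _ hst
  have hc : ∀ τ ∈ Icc s t, ∀ i j, |x τ i - x τ j| < 1 →
      clusterMean (x s) i = clusterMean (x s) j := fun τ hτ i j h =>
    clusterMean_eq_of_reachable (hx.reachable_of_abs_lt hg hs hτ.1 h)
  refine (localVariance_le (x t) _ (hc t ⟨hst, le_rfl⟩)).trans ?_
  exact mul_le_mul_of_nonneg_left (hx.sum_sq_sub_const_le _ hs hst hc) (by positivity)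

end IsCaratheodorySolution

end HK

theorem mainTheorem2 (n : ℕ) (t₀ : ℝ) :
    (∀ᵐ x₀ : Fin n → ℝ ∂(MeasureTheory.volume : MeasureTheory.Measure (Fin n → ℝ)),
      ∀ x : ℝ → Fin n → ℝ, HK.IsCaratheodorySolution t₀ x → x t₀ = x₀ →
        AntitoneOn (fun t => HK.localVariance (x t)) (Set.Ici t₀)) ∧
    (∀ x : ℝ → Fin n → ℝ, HK.IsCaratheodorySolution t₀ x →
      Filter.Tendsto (fun t => HK.localVariance (x t)) Filter.atTop (nhds 0)) := by
  refine ⟨?_, fun x hx => hx.tendsto_localVariance⟩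
  filter_upwards [HK.ae_isGeneric t₀] with x₀ h x hx h0
  exact hx.antitoneOn_localVariance (h x hx h0)
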